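/- Let $T$ be a complete first-order theory in a (one-sorted) language $L$, and let $\mathfrak C\models T$ be $\kappa$-saturated for some uncountable cardinal $\kappa$ (for instance, a monster model of $T$). Let $x,y$ be finite tuples of variables, $\varphi(x;y)$ an $L$-formula, $p(x)$ a set of $L$-formulas in $x$ (a partial type without parameters), and $n<\omega$. All tuples are from $\mathfrak C$. A sequence of $|y|$-tuples indexed by a linear order is *indiscernible* if any two strictly increasing finite subsequences of the same length satisfy the same $L$-formulas; finite sequences are taken non-empty. For $B\subseteq\mathfrak C^{|y|}$, let $S_\varphi(B)\cap[p]$ be the set of all maximal subsets of $\{\varphi(x;b):b\in B\}\cup\{\neg\varphi(x;b):b\in B\}$ that are consistent with $p(x)$ (finitely satisfiable in $\mathfrak C$ together with $p$). A formula $\psi(y)$ (with parameters) *defines* $q\in S_\varphi(B)\cap[p]$ if for all $b\in B$: $\models\psi(b)$ if and only if $\varphi(x;b)\in q$. * $\varphi$ has *local dp-rank $\le n$ with respect to $p$* if for all $a\models p$ and all indiscernible sequences $\langle b_i:i\in\mathbb Q\rangle$ there is $C\subseteq\mathbb R$ with $|C|\le n$ such that for all $i,j\in\mathbb Q$ with $i\sim_C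 j$ we have $\models\varphi(a;b_i)\leftrightarrow\varphi(a;b_j)$. Here $i\sim_C j$ means that for all $c\in C$: $c\le i\Leftrightarrow c\le j$ and $i\le c\Leftrightarrow j\le c$. * $\varphi$ has *UDTFS$_{\mathrm{ind}}$-rank $\le n$ with respect to $p$* if there are $\ell,k,R<\omega$ and $L$-formulas $\psi_r(y;z_{1,0},\dots,z_{1,\ell},\dots,z_{n,0},\dots,z_{n,\ell},w_1,\dots,w_k)$, $r<R$ (all $z$'s and $w$'s being $|y|$-tuples of variables), such that for every finite indiscernible sequence $\langle b_i:i<N\rangle$, $N\ge 1$, there are $j_1,\dots,j_k<N$ such that for every $q\in S_\varphi(\{b_i:i<N\})\cap[p]$ there are $i_1,\dots,i_n<N$ and $r<R$ for which $\psi_r(y;b_{i_1},\dots,b_{i_1+\ell},\dots,b_{i_n},\dots,b_{i_n+\ell},b_{j_1},\dots,b_{j_k})$ defines $q$; an entry $b_m$ with $m\ge N$ is read as $b_{N-1}$. * For $\ell\in\mathbb R$, $\varphi$ has *VC$_{\mathrm{ind}}$-density $\le\ell$ with respect to $p$* if there is $K\in\mathbb R$ such that for every finite indiscernible sequence $\langle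 b_i:i<N\rangle$, $N\ge1$, with $B=\{b_i:i<N\}$, $|S_\varphi(B)\cap[p]|\le K\cdot N^\ell$. Then the following four conditions are equivalent: 1. $\varphi$ has local dp-rank $\le n$ with respect to $p$; 2. $\varphi$ has UDTFS$_{\mathrm{ind}}$-rank $\le n$ with respect to $p$; 3. $\varphi$ has VC$_{\mathrm{ind}}$-density $\le n$ with respect to $p$; 4. $\varphi$ has VC$_{\mathrm{ind}}$-density $\le\ell$ with respect to $p$ for some $\ell\in\mathbb R$ with $n\le\ell<n+1$. -/

import Mathlib

open FirstOrder Cardinal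

universe u v w x y

namespace LocalRank

variable {L : FirstOrder.Language.{u, v}} {M : Type w} [L.Structure M] {α : Type x} {β : Type y}

/-- `M` is `κ`-saturated: every set of formulas in one variable, with parameters from a subset
`A ⊆ M` of size less than `κ`, that is finitely satisfiable in `M` is realized in `M`. -/
def IsSaturated (L : FirstOrder.Language.{u, v}) (M : Type w) [L.Structure M]
    (κ : Cardinal.{w}) : Prop :=
  ∀ A : Set M, #A < κ → ∀ Γ : Set (L[[A]].Formula Unit),
    (∀ Γ₀ : Finset (L[[A]].Formula Unit), (Γ₀ : Set (L[[A]].Formula Unit)) ⊆ Γ →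
      ∃ c : M, ∀ ψ ∈ Γ₀, ψ.Realize (fun _ => c)) →
    ∃ c : M, ∀ ψ ∈ Γ, ψ.Realize (fun _ => c)

/-- `a ⊨ p(x)`, for a set `p` of `L`-formulas (without parameters) in the variables `x`. -/
def Realizes (p : Set (L.Formula α)) (a : α → M) : Prop :=
  ∀ ψ ∈ p, ψ.Realize a

/-- The sequence `⟨b_i : i ∈ I⟩` of `β`-tuples of `M` is indiscernible (over the empty set): any
two strictly increasing finite subsequences of the same length satisfy the same `L`-formulas. -/
def Indiscernible (L : FirstOrder.Language.{u, v}) {M : Type w} [L.Structure M] {β : Type y}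
    {I : Type*} [LinearOrder I] (b : I → β → M) : Prop :=
  ∀ (m : ℕ) (ψ : L.Formula (Fin m × β)) (f g : Fin m → I), StrictMono f → StrictMono g →
    (ψ.Realize (fun v => b (f v.1) v.2) ↔ ψ.Realize (fun v => b (g v.1) v.2))

/-- `a` satisfies a signed instance of `φ(x;y)`: the pair `(b, true)` stands for the formula
`φ(x;b)` and the pair `(b, false)` for the formula `¬φ(x;b)`. -/
def SatisfiesInstance (φ : L.Formula (α ⊕ β)) (a : α → M) (e : (β → M) × Bool) : Prop :=
  φ.Realize (Sum.elim a e.1) ↔ e.2 = true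

/-- The set `s` of signed instances of `φ` is consistent with `p(x)`, i.e. `p` together with the
formulas in `s` is finitely satisfiable in `M`. -/
def ConsistentWith (φ : L.Formula (α ⊕ β)) (p : Set (L.Formula α))
    (s : Set ((β → M) × Bool)) : Prop :=
  ∀ p₀ : Finset (L.Formula α), (p₀ : Set (L.Formula α)) ⊆ p →
    ∀ s₀ : Finset ((β → M) × Bool), (s₀ : Set ((β → M) × Bool)) ⊆ s →
      ∃ a : α → M, (∀ ψ ∈ p₀, ψ.Realize a) ∧ ∀ e ∈ s₀, SatisfiesInstance φ a e

/-- `S_φ(B) ∩ [p]`: the maximal subsets of `{φ(x;b) : b ∈ B} ∪ {¬φ(x;b) : b ∈ B}` that are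
consistent with `p(x)`. -/
def phiTypes (φ : L.Formula (α ⊕ β)) (p : Set (L.Formula α)) (B : Set (β → M)) :
    Set (Set ((β → M) × Bool)) :=
  {q | Maximal (fun s => (∀ e ∈ s, e.1 ∈ B) ∧ ConsistentWith φ p s) q}

/-- For `C ⊆ ℝ` and `i, j ∈ ℚ`: `i ∼_C j` iff every `c ∈ C` satisfies `c ≤ i ↔ c ≤ j` and
`i ≤ c ↔ j ≤ c`. -/
def SimC (C : Set ℝ) (i j : ℚ) : Prop :=
  ∀ c ∈ C, (c ≤ (i : ℝ) ↔ c ≤ (j : ℝ)) ∧ ((i : ℝ) ≤ c ↔ (j : ℝ) ≤ c)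

/-- `φ(x;y)` has local dp-rank `≤ n` with respect to `p(x)`. -/
def LocalDpRankLE (M : Type w) [L.Structure M] (φ : L.Formula (α ⊕ β)) (p : Set (L.Formula α))
    (n : ℕ) : Prop :=
  ∀ a : α → M, Realizes p a → ∀ b : ℚ → β → M, Indiscernible L b →
    ∃ C : Set ℝ, C.encard ≤ n ∧
      ∀ i j : ℚ, SimC C i j → (φ.Realize (Sum.elim a (b i)) ↔ φ.Realize (Sum.elim a (b j)))

/-- `φ(x;y)` has VC_ind-density `≤ ℓ` with respect to `p(x)` (sequences are non-empty). -/
def VCindDensityLE (M : Type w) [L.Structure M] (φ : L.Formula (α ⊕ β)) (p : Set (L.Formula α))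
    (ℓ : ℝ) : Prop :=
  ∃ K : ℝ, ∀ N : ℕ, 0 < N → ∀ b : Fin N → β → M, Indiscernible L b →
    ((phiTypes φ p (Set.range b)).ncard : ℝ) ≤ K * (N : ℝ) ^ ℓ

/-- The formula `ψ(y; z)` with parameters `c` for `z` defines the `φ`-type `q` over `B`. -/
def Defines {γ : Type*} (B : Set (β → M)) (ψ : L.Formula (β ⊕ γ)) (c : γ → M)
    (q : Set ((β → M) × Bool)) : Prop :=
  ∀ b ∈ B, ψ.Realize (Sum.elim b c) ↔ (b, true) ∈ q

/-- The entry `b_m` of a finite sequence `⟨b_i : i < N⟩`, read as the last entry `b_{N-1}` if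
`m ≥ N`. -/
def entry {N : ℕ} (hN : 0 < N) (b : Fin N → β → M) (m : ℕ) : β → M :=
  b ⟨min m (N - 1), by omega⟩

/-- `φ(x;y)` has UDTFS_ind-rank `≤ n` with respect to `p(x)`. The variable `z_{t,s}` of a formula
`ψ_r(y; (z_{t,s})_{t, s ≤ ℓ}, w_1, …, w_k)` is the tuple of variables `Sum.inl ((t, s), ·)`, and
`w_h` is the tuple `Sum.inr (h, ·)`. -/
def UDTFSindRankLE (M : Type w) [L.Structure M] (φ : L.Formula (α ⊕ β)) (p : Set (L.Formula α))
    (n : ℕ) : Prop :=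
  ∃ (ℓ k R : ℕ)
    (ψ : Fin R → L.Formula (β ⊕ (((Fin n × Fin (ℓ + 1)) × β) ⊕ (Fin k × β)))),
    ∀ (N : ℕ) (hN : 0 < N) (b : Fin N → β → M), Indiscernible L b →
      ∃ j : Fin k → Fin N, ∀ q ∈ phiTypes φ p (Set.range b),
        ∃ (i : Fin n → Fin N) (r : Fin R),
          Defines (Set.range b) (ψ r)
            (Sum.elim (fun v => entry hN b ((i v.1.1 : ℕ) + (v.1.2 : ℕ)) v.2)
              (fun v => b (j v.1) v.2)) q

end LocalRank

/-! The four conditions are proved equivalent in a cycle 1 → 2 → 3 → 4 → 1. A type is determined by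
its defining formula, so 2 → 3 counts formulas and parameters; 3 → 4 is immediate.

For 4 → 1, let `f i` be the truth value of `φ(a;b_i)`. The reals near which `f` oscillates serve as
`C`, because `f` is constant on intervals that avoid them (`iff_of_simC_oscillationSet`). If there
were `n + 1` such reals, `f` would induce `m ^ (n + 1)` sign patterns on subsequences of length `(n
+ 1) * m` (`exists_patterns_of_oscillationSet`). Indiscernibility transports all of them to one
subsequence, which is too many for an exponent below `n + 1`.

For 1 → 2, rank at most `n` forbids a change of truth value in each of `n + 1` disjoint pairs. By
saturation, finitely many formulas of `p`, a finite set `Δ` of formulas and a finite `Q ⊆ ℚ` already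
forbid it (`LocalDpRankLE.exists_finset`), which makes the bound usable on finite sequences. There
is then a dichotomy. If `Δ` is symmetric on the sequence, its elements may be reordered at will, so
one truth value occurs at most `n` times, and those places are taken as parameters. Otherwise some
formula of `Δ` detects an adjacent swap (`Indiscernible.symmetric_or_swap`); with `b_i` and elements
near the ends as parameters, it separates two elements on opposite sides of `b_i`. The changes of
truth value away from the ends lie in `n` short windows; with the windows and the ends as
parameters, elements satisfying the same instances of `Δ` have the same truth value
(`Indiscernible.exists_blocks`). Finitely many Boolean combinations of instances of `Δ` and
equalities then suffice. -/

namespace LocalRank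

/-! ### Saturation for countably many variables -/

section Saturation

variable {L : FirstOrder.Language.{u, v}} {M : Type w} [L.Structure M] {V : Type*}

theorem realize_congr_freeVarFinset [DecidableEq V] (ψ : L.Formula V) {v v' : V → M}
    (h : ∀ i ∈ ψ.freeVarFinset, v i = v' i) : ψ.Realize v ↔ ψ.Realize v' := by
  have h1 := FirstOrder.Language.BoundedFormula.realize_restrictFreeVar (M := M) (φ := ψ)
    (f := id) (v := fun a => v a) (xs := default) v (fun _ => rfl)
  have h2 := FirstOrder.Language.BoundedFormula.realize_restrictFreeVar (M := M) (φ := ψ)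
    (f := id) (v := fun a => v a) (xs := default) v' (fun a => h a a.2)
  exact h1.symm.trans h2

/-- The projection to one coordinate of the solutions of finitely many formulas that take
prescribed values at finitely many variables is definable. -/
theorem exists_formula_partialAssignment (Γ : Finset (L.Formula V)) (F : Finset (V × M))
    (A : Set M) (hF : ∀ e ∈ F, e.2 ∈ A) (i : V) :
    ∃ ψ : L[[A]].Formula Unit, ∀ c : M, ψ.Realize (fun _ => c) ↔
      ∃ v : V → M, (∀ e ∈ F, v e.1 = e.2) ∧ v i = c ∧ ∀ θ ∈ Γ, θ.Realize v := by
  classical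
  let S : Finset V := insert i (F.image Prod.fst ∪ Γ.biUnion fun θ => θ.freeVarFinset)
  have hiS : i ∈ S := Finset.mem_insert_self _ _
  have hFS : ∀ e ∈ F, e.1 ∈ S := fun e he => Finset.mem_insert_of_mem
    (Finset.mem_union_left _ (Finset.mem_image_of_mem _ he))
  have hΓS : ∀ θ ∈ Γ, ∀ j ∈ θ.freeVarFinset, j ∈ S := fun θ hθ j hj => Finset.mem_insert_of_mem
    (Finset.mem_union_right _ (Finset.mem_biUnion.2 ⟨θ, hθ, hj⟩))
  let f : ∀ θ : Γ, θ.1.freeVarFinset → (A ⊕ Unit) ⊕ S :=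
    fun θ j => Sum.inr ⟨j.1, hΓS θ.1 θ.2 j.1 j.2⟩
  let χ₁ : L.Formula ((A ⊕ Unit) ⊕ S) := Language.Formula.iInf fun θ : Γ =>
    (Language.BoundedFormula.restrictFreeVar θ.1 (f θ) : L.Formula _)
  let χ₂ : L.Formula ((A ⊕ Unit) ⊕ S) := Language.Formula.iInf fun e : F =>
    Language.Term.equal (Language.Term.var (Sum.inr ⟨e.1.1, hFS e.1 e.2⟩))
      (Language.Term.var (Sum.inl (Sum.inl ⟨e.1.2, hF e.1 e.2⟩)))
  let χ₃ : L.Formula ((A ⊕ Unit) ⊕ S) :=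
    Language.Term.equal (Language.Term.var (Sum.inr ⟨i, hiS⟩))
      (Language.Term.var (Sum.inl (Sum.inr ())))
  let χ : L.Formula (A ⊕ Unit) := (χ₁ ⊓ (χ₂ ⊓ χ₃)).iExs S
  obtain ⟨ψ, hψ⟩ := Set.definable_iff_exists_formula_sum.2
    ⟨χ, (rfl : {v : Unit → M | χ.Realize (Sum.elim (↑) v)} = _)⟩
  refine ⟨ψ, fun c => ?_⟩
  have h1 : ψ.Realize (fun _ => c) ↔ χ.Realize (Sum.elim ((↑) : A → M) (fun _ : Unit => c)) :=
    (Set.ext_iff.1 hψ (fun _ => c)).symm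
  rw [h1, Language.Formula.realize_iExs]
  have h2 : ∀ (u : S → M) (v : V → M), (∀ j : S, u j = v j) →
      ((χ₁ ⊓ (χ₂ ⊓ χ₃)).Realize (Sum.elim (Sum.elim ((↑) : A → M) (fun _ : Unit => c)) u) ↔
        (∀ e ∈ F, v e.1 = e.2) ∧ v i = c ∧ ∀ θ ∈ Γ, θ.Realize v) := by
    intro u v huv
    have e1 : χ₁.Realize (Sum.elim (Sum.elim ((↑) : A → M) (fun _ : Unit => c)) u) ↔
        ∀ θ ∈ Γ, θ.Realize v := by
      simp only [χ₁, Language.Formula.realize_iInf, Subtype.forall]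
      refine forall₂_congr fun θ hθ => ?_
      exact Language.BoundedFormula.realize_restrictFreeVar v (fun j => huv _)
    have e2 : χ₂.Realize (Sum.elim (Sum.elim ((↑) : A → M) (fun _ : Unit => c)) u) ↔
        ∀ e ∈ F, v e.1 = e.2 := by
      simp only [χ₂, Language.Formula.realize_iInf, Subtype.forall, Language.Formula.realize_equal,
        Language.Term.realize_var, Sum.elim_inl, Sum.elim_inr, huv]
    have e3 : χ₃.Realize (Sum.elim (Sum.elim ((↑) : A → M) (fun _ : Unit => c)) u) ↔
        v i = c := by
      simp only [χ₃, Language.Formula.realize_equal, Language.Term.realize_var, Sum.elim_inl,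
        Sum.elim_inr, huv]
    rw [Language.Formula.realize_inf, Language.Formula.realize_inf, e1, e2, e3]
    tauto
  constructor
  · rintro ⟨u, hu⟩
    -- No formula mentions variables outside `S`; they get the value at `i`, which is why `i` was
    -- put into `S`.
    exact ⟨fun j => if h : j ∈ S then u ⟨j, h⟩ else u ⟨i, hiS⟩,
      (h2 u (fun j => if h : j ∈ S then u ⟨j, h⟩ else u ⟨i, hiS⟩) (fun j => by simp)).1 hu⟩
  · rintro ⟨v, hv⟩
    exact ⟨fun j => v j, (h2 _ v fun _ => rfl).2 hv⟩

/-- In a `κ`-saturated structure with `κ` uncountable, every finitely satisfiable set of formulas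
without parameters in countably many variables is realized. -/
theorem IsSaturated.exists_realize {κ : Cardinal.{w}} (hκ : ℵ₀ < κ) (hM : IsSaturated L M κ)
    [Countable V] (Γ : Set (L.Formula V))
    (hΓ : ∀ Γ₀ : Finset (L.Formula V), (Γ₀ : Set (L.Formula V)) ⊆ Γ →
      ∃ v : V → M, ∀ ψ ∈ Γ₀, ψ.Realize v) :
    ∃ v : V → M, ∀ ψ ∈ Γ, ψ.Realize v := by
  classical
  -- Partial assignments are sets of pairs (variable, value); a maximal one that is finitely
  -- satisfiable with `Γ` turns out to be total.
  let P : Set (Set (V × M)) := {G | ∀ Γ₀ : Finset (L.Formula V), (Γ₀ : Set (L.Formula V)) ⊆ Γ →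
    ∀ F : Finset (V × M), (F : Set (V × M)) ⊆ G →
      ∃ v : V → M, (∀ e ∈ F, v e.1 = e.2) ∧ ∀ ψ ∈ Γ₀, ψ.Realize v}
  have hP0 : ∅ ∈ P := by
    intro Γ₀ h F hF
    obtain ⟨v, hv⟩ := hΓ Γ₀ h
    exact ⟨v, fun e he => (hF he).elim, hv⟩
  obtain ⟨G, -, hG⟩ := zorn_subset_nonempty P (by
    intro c hc hchain hne
    refine ⟨⋃₀ c, ?_, fun s hs => Set.subset_sUnion_of_mem hs⟩
    intro Γ₀ h F hF
    obtain ⟨t, ht, hFt⟩ := DirectedOn.exists_mem_subset_of_finset_subset_biUnion (f := id) hne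
      (hchain.directedOn) (s := F) (by simpa [Set.sUnion_eq_biUnion] using hF)
    exact hc ht Γ₀ h F hFt) ∅ hP0
  have hfun : ∀ i c c', (i, c) ∈ G → (i, c') ∈ G → c = c' := by
    intro i c c' h h'
    obtain ⟨v, hv, -⟩ := hG.1 ∅ (by simp) {(i, c), (i, c')} (by
      intro e he
      simp only [Finset.coe_insert, Finset.coe_singleton, Set.mem_insert_iff,
        Set.mem_singleton_iff] at he
      rcases he with rfl | rfl <;> assumption)
    have h1 := hv (i, c) (by simp)
    have h2 := hv (i, c') (by simp)
    exact h1.symm.trans h2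
  have hcount : G.Countable := by
    refine Set.MapsTo.countable_of_injOn (f := Prod.fst) (t := Set.univ) (fun _ _ => trivial) ?_
      Set.countable_univ
    rintro ⟨i, c⟩ h ⟨j, c'⟩ h' hij
    obtain rfl : i = j := hij
    rw [hfun i c c' h h']
  have htot : ∀ i, ∃ c, (i, c) ∈ G := by
    intro i
    let A : Set M := Prod.snd '' G
    have hA : #A < κ := lt_of_le_of_lt (Cardinal.le_aleph0_iff_set_countable.2
      (hcount.image _)) hκ
    -- This one-variable type says that the value at `i` extends, for every finite part of `Γ` and
    -- of `G`, to a solution. Its parameters are the countably many values in `G`.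
    obtain ⟨c, hc⟩ := hM A hA {ψ | ∃ (Γ₀ : Finset (L.Formula V)) (F : Finset (V × M)),
        (Γ₀ : Set (L.Formula V)) ⊆ Γ ∧ (F : Set (V × M)) ⊆ G ∧
        ∀ c : M, ψ.Realize (fun _ => c) ↔
          ∃ v : V → M, (∀ e ∈ F, v e.1 = e.2) ∧ v i = c ∧ ∀ θ ∈ Γ₀, θ.Realize v} (by
      intro Δ hΔ
      choose! Γ' F' h1 h2 h3 using hΔ
      obtain ⟨v, hv, hv'⟩ := hG.1 (Δ.biUnion Γ') (by
        intro θ hθ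
        obtain ⟨ψ, hψ, hθ⟩ := Finset.mem_biUnion.1 (Finset.mem_coe.1 hθ)
        exact h1 hψ hθ) (Δ.biUnion F') (by
        intro θ hθ
        obtain ⟨ψ, hψ, hθ⟩ := Finset.mem_biUnion.1 (Finset.mem_coe.1 hθ)
        exact h2 hψ hθ)
      refine ⟨v i, fun ψ hψ => (h3 hψ _).2 ⟨v, fun e he => hv e ?_, rfl, fun θ hθ => hv' θ ?_⟩⟩
      · exact Finset.mem_biUnion.2 ⟨ψ, hψ, he⟩
      · exact Finset.mem_biUnion.2 ⟨ψ, hψ, hθ⟩)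
    refine ⟨c, ?_⟩
    have hins : insert (i, c) G ∈ P := by
      intro Γ₀ hΓ₀ F hF
      have hF' : ((F.erase (i, c) : Finset (V × M)) : Set (V × M)) ⊆ G := by
        intro e he
        have he := Finset.mem_erase.1 (Finset.mem_coe.1 he)
        exact (hF he.2).resolve_left he.1
      obtain ⟨ψ, hψ⟩ := exists_formula_partialAssignment Γ₀ (F.erase (i, c)) A
        (fun e he => ⟨e, hF' he, rfl⟩) i
      obtain ⟨v, h1, h2, h3⟩ := (hψ c).1 (hc ψ ⟨Γ₀, _, hΓ₀, hF', hψ⟩)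
      refine ⟨v, fun e he => ?_, h3⟩
      by_cases hei : e = (i, c)
      · rw [hei]; exact h2
      · exact h1 e (Finset.mem_erase.2 ⟨hei, he⟩)
    exact hG.2 hins (Set.subset_insert _ _) (Set.mem_insert _ _)
  choose v hv using htot
  refine ⟨v, fun ψ hψ => ?_⟩
  obtain ⟨v', h1, h2⟩ := hG.1 {ψ} (by simpa using hψ)
    (ψ.freeVarFinset.image fun i => (i, v i)) (by
      intro e he
      obtain ⟨i, -, rfl⟩ := Finset.mem_image.1 (Finset.mem_coe.1 he)
      exact hv i)
  refine (realize_congr_freeVarFinset ψ fun i hi => ?_).1 (h2 ψ (by simp))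
  exact h1 (i, v i) (Finset.mem_image.2 ⟨i, hi, rfl⟩)

end Saturation

/-! ### Local types over a set of tuples -/

section PhiTypes

variable {L : FirstOrder.Language.{u, v}} {M : Type w} [L.Structure M] {α : Type x} {β : Type y}
  {φ : L.Formula (α ⊕ β)} {p : Set (L.Formula α)}

theorem ConsistentWith.sign_unique {s : Set ((β → M) × Bool)} (h : ConsistentWith φ p s)
    {b : β → M} {t t' : Bool} (ht : (b, t) ∈ s) (ht' : (b, t') ∈ s) : t = t' := by
  classical
  obtain ⟨a, -, ha⟩ := h ∅ (by simp) {(b, t), (b, t')} (by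
    intro e he
    simp only [Finset.coe_insert, Finset.coe_singleton, Set.mem_insert_iff,
      Set.mem_singleton_iff] at he
    rcases he with rfl | rfl <;> assumption)
  have h1 : _ ↔ t = true := ha (b, t) (by simp)
  have h2 : _ ↔ t' = true := ha (b, t') (by simp)
  exact Bool.eq_iff_iff.2 (h1.symm.trans h2)

theorem mem_phiTypes_of_total {B : Set (β → M)} {q : Set ((β → M) × Bool)}
    (hqB : ∀ e ∈ q, e.1 ∈ B) (hq : ConsistentWith φ p q) (htot : ∀ b ∈ B, ∃ t, (b, t) ∈ q) :
    q ∈ phiTypes φ p B := by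
  refine ⟨⟨hqB, hq⟩, fun s hs hqs => ?_⟩
  rintro ⟨b, t⟩ he
  obtain ⟨t', ht'⟩ := htot b (hs.1 _ he)
  rwa [hs.2.sign_unique he (hqs ht')]

/-- Were neither sign at `b` addable to the maximal set `q`, finitely many conditions would refute
each. A tuple satisfying all of these conditions other than the two instances at `b` could satisfy
neither `φ(x;b)` nor its negation. -/
theorem exists_mem_of_mem_phiTypes {B : Set (β → M)} {q : Set ((β → M) × Bool)}
    (hq : q ∈ phiTypes φ p B) {b : β → M} (hb : b ∈ B) : ∃ t, (b, t) ∈ q := by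
  classical
  by_contra! hcon
  have key : ∀ t : Bool, ∃ (p₀ : Finset (L.Formula α)) (s₀ : Finset ((β → M) × Bool)),
      (p₀ : Set (L.Formula α)) ⊆ p ∧ (s₀ : Set ((β → M) × Bool)) ⊆ insert (b, t) q ∧
      ∀ a : α → M, (∀ ψ ∈ p₀, ψ.Realize a) → ∃ e ∈ s₀, ¬ SatisfiesInstance φ a e := by
    intro t
    have hnot : ¬ ConsistentWith φ p (insert (b, t) q) := by
      intro h
      refine hcon t (hq.2 ⟨?_, h⟩ (Set.subset_insert _ _) (Set.mem_insert _ _))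
      rintro e (rfl | he)
      · exact hb
      · exact hq.1.1 e he
    unfold ConsistentWith at hnot
    push Not at hnot
    obtain ⟨p₀, h1, s₀, h2, h3⟩ := hnot
    exact ⟨p₀, s₀, h1, h2, h3⟩
  choose p₀ s₀ h1 h2 h3 using key
  obtain ⟨a, ha, ha'⟩ := hq.1.2 (p₀ true ∪ p₀ false) (by
    rw [Finset.coe_union]; exact Set.union_subset (h1 _) (h1 _))
    ((s₀ true).erase (b, true) ∪ (s₀ false).erase (b, false)) (by
      intro e he
      rcases Finset.mem_union.1 (Finset.mem_coe.1 he) with he | he <;>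
      · rw [Finset.mem_erase] at he
        exact (h2 _ (Finset.mem_coe.2 he.2)).resolve_left he.1)
  have hfail : ∀ t : Bool, (∀ ψ ∈ p₀ t, ψ.Realize a) →
      (∀ e ∈ (s₀ t).erase (b, t), SatisfiesInstance φ a e) →
      ¬ SatisfiesInstance φ a (b, t) := by
    intro t hp hs hbt
    obtain ⟨e, he, hne⟩ := h3 t a hp
    by_cases heb : e = (b, t)
    · rw [heb] at hne; exact hne hbt
    · exact hne (hs e (Finset.mem_erase.2 ⟨heb, he⟩))
  have ht := hfail true (fun ψ hψ => ha ψ (Finset.mem_union_left _ hψ))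
    (fun e he => ha' e (Finset.mem_union_left _ he))
  have hf := hfail false (fun ψ hψ => ha ψ (Finset.mem_union_right _ hψ))
    (fun e he => ha' e (Finset.mem_union_right _ he))
  simp [SatisfiesInstance] at ht hf
  exact ht hf

theorem eq_of_mem_phiTypes {B : Set (β → M)} {q q' : Set ((β → M) × Bool)}
    (hq : q ∈ phiTypes φ p B) (hq' : q' ∈ phiTypes φ p B)
    (h : ∀ b ∈ B, (b, true) ∈ q ↔ (b, true) ∈ q') : q = q' := by
  have key : ∀ {q q' : Set ((β → M) × Bool)}, q ∈ phiTypes φ p B → q' ∈ phiTypes φ p B →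
      (∀ b ∈ B, (b, true) ∈ q ↔ (b, true) ∈ q') → q ⊆ q' := by
    rintro q q' hq hq' h ⟨b, t⟩ he
    have hb := hq.1.1 _ he
    obtain ⟨t', ht'⟩ := exists_mem_of_mem_phiTypes hq' hb
    have : t = t' := by
      cases t with
      | true => exact hq'.1.2.sign_unique ((h b hb).1 he) ht'
      | false =>
        cases t' with
        | false => rfl
        | true => exact hq.1.2.sign_unique he ((h b hb).2 ht')
    rwa [this]
  exact (key hq hq' h).antisymm (key hq' hq fun b hb => (h b hb).symm)

theorem finite_phiTypes {B : Set (β → M)} (hB : B.Finite) : (phiTypes φ p B).Finite := by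
  refine ((hB.prod (Set.finite_univ (α := Bool))).finite_subsets).subset ?_
  intro q hq e he
  exact ⟨hq.1.1 e he, trivial⟩

/-- A `φ`-type over finitely many tuples is induced by realizations of finite parts of `p`. -/
theorem exists_realize_of_mem_phiTypes {B : Set (β → M)} (hB : B.Finite)
    {q : Set ((β → M) × Bool)} (hq : q ∈ phiTypes φ p B) (p₀ : Finset (L.Formula α))
    (hp₀ : (p₀ : Set (L.Formula α)) ⊆ p) :
    ∃ a : α → M, (∀ ψ ∈ p₀, ψ.Realize a) ∧
      ∀ b ∈ B, (φ.Realize (Sum.elim a b) ↔ (b, true) ∈ q) := by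
  have hfin : q.Finite := (hB.prod (Set.finite_univ (α := Bool))).subset
    fun e he => ⟨hq.1.1 e he, trivial⟩
  obtain ⟨a, ha, ha'⟩ := hq.1.2 p₀ hp₀ hfin.toFinset (by simp)
  refine ⟨a, ha, fun b hb => ?_⟩
  obtain ⟨t, ht⟩ := exists_mem_of_mem_phiTypes hq hb
  have h1 : _ ↔ t = true := ha' (b, t) (by simpa using ht)
  rw [show φ.Realize (Sum.elim a b) ↔ t = true from h1]
  constructor
  · rintro rfl; exact ht
  · intro h; exact hq.1.2.sign_unique ht h

/-- The indices `j` depend only on the sequence, so a type is recovered from `(i, r)`, with `N ^ n *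
R` choices. -/
theorem UDTFSindRankLE.vcIndDensityLE {n : ℕ} (h : UDTFSindRankLE M φ p n) :
    VCindDensityLE M φ p (n : ℝ) := by
  classical
  obtain ⟨ℓ, k, R, ψ, h⟩ := h
  refine ⟨R, fun N hN b hb => ?_⟩
  obtain ⟨j, hj⟩ := h N hN b hb
  have hq : ∀ q : phiTypes φ p (Set.range b), ∃ ir : (Fin n → Fin N) × Fin R,
      Defines (Set.range b) (ψ ir.2)
        (Sum.elim (fun v => entry hN b ((ir.1 v.1.1 : ℕ) + (v.1.2 : ℕ)) v.2)
          (fun v => b (j v.1) v.2)) q.1 := by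
    rintro ⟨q, hq⟩
    obtain ⟨i, r, h⟩ := hj q hq
    exact ⟨(i, r), h⟩
  choose F hF using hq
  have hinj : Function.Injective F := by
    intro q q' hqq
    refine Subtype.ext (eq_of_mem_phiTypes q.2 q'.2 fun b' hb' => ?_)
    have h1 := hF q b' hb'
    rw [hqq] at h1
    exact h1.symm.trans (hF q' b' hb')
  have hcard := Nat.card_le_card_of_injective F hinj
  rw [Nat.card_eq_fintype_card (α := (Fin n → Fin N) × Fin R)] at hcard
  simp only [Fintype.card_prod, Fintype.card_fun, Fintype.card_fin] at hcard
  rw [Set.ncard_def, Set.encard, Real.rpow_natCast, mul_comm]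
  exact_mod_cast hcard

/-- Every sign pattern of a realization of `p` on some increasing subsequence of an indiscernible
sequence is consistent with `p` on any other increasing subsequence of the same length. -/
theorem Indiscernible.consistentWith_of_strictMono [Finite α] {I : Type*} [LinearOrder I]
    {b : I → β → M} (hb : Indiscernible L b) {a : α → M} (ha : Realizes p a) {N : ℕ}
    {f g : Fin N → I} (hf : StrictMono f) (hg : StrictMono g) (t : Fin N → Bool)
    (ht : ∀ i, φ.Realize (Sum.elim a (b (g i))) ↔ t i = true) :
    ConsistentWith φ p (Set.range fun i => (b (f i), t i)) := by
  classical
  intro p₀ hp₀ s₀ hs₀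
  -- Quantifying out the finite tuple `a` expresses the existence of a realization of `p₀` with sign
  -- pattern `t` by a formula in the sequence elements alone, to which indiscernibility applies.
  let χ₁ : L.Formula ((Fin N × β) ⊕ α) :=
    Language.Formula.iInf fun ψ : p₀ => ψ.1.relabel Sum.inr
  let χ₂ : L.Formula ((Fin N × β) ⊕ α) := Language.Formula.iInf fun i : Fin N =>
    if t i = true then φ.relabel (Sum.elim Sum.inr fun j => Sum.inl (i, j))
      else (φ.relabel (Sum.elim Sum.inr fun j => Sum.inl (i, j))).not
  have hreal : ∀ c : Fin N → β → M,
      ((χ₁ ⊓ χ₂).iExs α).Realize (fun v : Fin N × β => c v.1 v.2) ↔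
        ∃ a : α → M, (∀ ψ ∈ p₀, ψ.Realize a) ∧
          ∀ i, (φ.Realize (Sum.elim a (c i)) ↔ t i = true) := by
    intro c
    rw [Language.Formula.realize_iExs]
    refine exists_congr fun a => ?_
    rw [Language.Formula.realize_inf]
    refine and_congr ?_ ?_
    · simp only [χ₁, Language.Formula.realize_iInf, Language.Formula.realize_relabel,
        Sum.elim_comp_inr, Subtype.forall]
    · simp only [χ₂, Language.Formula.realize_iInf]
      refine forall_congr' fun i => ?_
      have h1 : (Sum.elim (fun v : Fin N × β => c v.1 v.2) a ∘
          (Sum.elim Sum.inr fun j => Sum.inl (i, j))) = Sum.elim a (c i) := by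
        funext v; cases v <;> rfl
      cases hti : t i <;> simp [Language.Formula.realize_not, Language.Formula.realize_relabel, h1]
  obtain ⟨a', h1, h2⟩ := (hreal fun i => b (f i)).1 ((hb N _ f g hf hg).2
    ((hreal fun i => b (g i)).2 ⟨a, fun ψ hψ => ha ψ (hp₀ hψ), ht⟩))
  refine ⟨a', h1, fun e he => ?_⟩
  obtain ⟨i, rfl⟩ := hs₀ he
  exact h2 i

end PhiTypes

/-! ### Oscillation of truth values along the rationals -/

section Alternation

theorem exists_strictMono_homogeneous (f : ℚ → Prop) {l r : ℝ} (h : l < r) :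
    ∃ (D : ℕ → ℚ) (c : Prop), StrictMono D ∧
      ∀ k, l < (D k : ℝ) ∧ (D k : ℝ) < r ∧ (f (D k) ↔ c) := by
  obtain ⟨q₁, h1, h2⟩ := exists_rat_btwn h
  obtain ⟨q₂, h3, h4⟩ := exists_rat_btwn h2
  have h3' : q₁ < q₂ := by exact_mod_cast h3
  obtain ⟨D, hD, hD', -⟩ := exists_seq_strictMono_tendsto' h3'
  have hmem : ∀ k, l < (D k : ℝ) ∧ (D k : ℝ) < r := by
    intro k
    constructor
    · exact h1.trans (by exact_mod_cast (hD' k).1)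
    · exact lt_trans (by exact_mod_cast (hD' k).2) h4
  by_cases hfr : ∃ᶠ k in Filter.atTop, f (D k)
  · obtain ⟨ι, hι, hf⟩ := Filter.extraction_of_frequently_atTop hfr
    exact ⟨D ∘ ι, True, hD.comp hι, fun k => ⟨(hmem _).1, (hmem _).2, by simpa using hf k⟩⟩
  · obtain ⟨ι, hι, hf⟩ := Filter.extraction_of_eventually_atTop (Filter.not_frequently.1 hfr)
    exact ⟨D ∘ ι, False, hD.comp hι, fun k => ⟨(hmem _).1, (hmem _).2, by simpa using hf k⟩⟩

/-- The reals near which `f : ℚ → Prop` is not constant. -/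
def oscillationSet (f : ℚ → Prop) : Set ℝ :=
  {c | ∀ ε > 0, ∃ i j : ℚ, |(i : ℝ) - c| < ε ∧ |(j : ℝ) - c| < ε ∧ f i ∧ ¬ f j}

/-- If `i ∼ j` and `i < j`, no oscillation point lies in `[i, j]`, endpoints included. So `f` is
locally constant along this connected set. -/
theorem iff_of_simC_oscillationSet (f : ℚ → Prop) {i j : ℚ} (h : SimC (oscillationSet f) i j) :
    f i ↔ f j := by
  wlog hij : i ≤ j generalizing i j
  · exact (this (fun c hc => ⟨(h c hc).1.symm, (h c hc).2.symm⟩) (le_of_not_ge hij)).symm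
  rcases hij.eq_or_lt with rfl | hlt
  · rfl
  let U : Prop → Set ℝ := fun P => {r | ∃ ε > 0, ∀ k : ℚ, |(k : ℝ) - r| < ε → (f k ↔ P)}
  have hU : ∀ P, IsOpen (U P) := by
    intro P
    rw [Metric.isOpen_iff]
    rintro r ⟨ε, hε, hr⟩
    refine ⟨ε / 2, by positivity, fun r' hr' => ⟨ε / 2, by positivity, fun k hk => hr k ?_⟩⟩
    rw [Metric.mem_ball, Real.dist_eq] at hr'
    calc |(k : ℝ) - r| ≤ |(k : ℝ) - r'| + |r' - r| := abs_sub_le _ _ _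
      _ < ε := by linarith
  have hdisj : Disjoint (U True) (U False) := by
    rw [Set.disjoint_left]
    rintro r ⟨ε, hε, h1⟩ ⟨ε', hε', h2⟩
    obtain ⟨k, hk1, hk2⟩ := exists_rat_btwn (show r < r + min ε ε' by
      have := lt_min hε hε'; linarith)
    have hk : |(k : ℝ) - r| < min ε ε' := by
      rw [abs_of_pos (by linarith)]; linarith
    exact (h2 k (hk.trans_le (min_le_right _ _))).1
      ((h1 k (hk.trans_le (min_le_left _ _))).2 trivial)
  have hlt' : (i : ℝ) < j := by exact_mod_cast hlt
  have hcover : Set.Icc (i : ℝ) j ⊆ U True ∪ U False := by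
    intro r hr
    have hr' : r ∉ oscillationSet f := by
      intro hro
      have := h r hro
      have h1 : (j : ℝ) ≤ r := this.2.1 hr.1
      have h2 : r ≤ (i : ℝ) := this.1.2 hr.2
      linarith
    simp only [oscillationSet, Set.mem_ofPred_eq, not_forall] at hr'
    obtain ⟨ε, hε, hr'⟩ := hr'
    by_cases hk : ∃ k : ℚ, |(k : ℝ) - r| < ε ∧ f k
    · obtain ⟨k, hk, hfk⟩ := hk
      refine Or.inl ⟨ε, hε, fun k' hk' => ?_⟩
      simp only [iff_true]
      by_contra hn
      exact hr' ⟨k, k', hk, hk', hfk, hn⟩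
    · exact Or.inr ⟨ε, hε, fun k' hk' => by
        simp only [iff_false]; exact fun hf => hk ⟨k', hk', hf⟩⟩
  have hU' : ∀ P (k : ℚ), (k : ℝ) ∈ U P → (f k ↔ P) := by
    rintro P k ⟨ε, hε, hk⟩
    exact hk k (by simpa using hε)
  have hi : (i : ℝ) ∈ Set.Icc (i : ℝ) j := ⟨le_rfl, hlt'.le⟩
  have hj : (j : ℝ) ∈ Set.Icc (i : ℝ) j := ⟨hlt'.le, le_rfl⟩
  rcases isPreconnected_Icc.subset_or_subset (hU _) (hU _) hdisj hcover with hs | hs <;>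
  · rw [hU' _ i (hs hi), hU' _ j (hs hj)]

/-- If `f : ℚ → Prop` oscillates at more than `n` points, then there are `n + 2` increasing
homogeneous sequences, separated by points at which `f` can take the value different from
that on the sequence to the left. -/
theorem exists_blocks_of_oscillationSet (f : ℚ → Prop) (n : ℕ)
    (h : ¬ (oscillationSet f).encard ≤ n) :
    ∃ (D : Fin (n + 2) → ℕ → ℚ) (c : Fin (n + 2) → Prop) (e : Fin (n + 1) → ℚ),
      (∀ t, StrictMono (D t)) ∧ (∀ t k, f (D t k) ↔ c t) ∧
      (∀ t : Fin (n + 1), ¬ (f (e t) ↔ c t.castSucc)) ∧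
      (∀ (t : Fin (n + 1)) k, D t.castSucc k < e t) ∧
      (∀ (t : Fin (n + 1)) k, e t < D t.succ k) := by
  have h' : ((n + 1 : ℕ) : ℕ∞) ≤ (oscillationSet f).encard := by
    push_cast
    exact Order.add_one_le_of_lt (not_le.1 h)
  obtain ⟨s, hs, hcard⟩ := Set.exists_subset_encard_eq h'
  have hfin : s.Finite := Set.finite_of_encard_eq_coe hcard
  have hcard' : hfin.toFinset.card = n + 1 := by
    rw [hfin.encard_eq_coe_toFinset_card] at hcard
    exact_mod_cast hcard
  let c₀ := hfin.toFinset.orderEmbOfFin hcard'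
  have hc₀ : ∀ t, c₀ t ∈ oscillationSet f := fun t =>
    hs (hfin.mem_toFinset.1 (Finset.orderEmbOfFin_mem hfin.toFinset hcard' t))
  obtain ⟨ε, hε, hgap⟩ : ∃ ε > 0, ∀ t t' : Fin (n + 1), t < t' → c₀ t + ε < c₀ t' - ε := by
    have hev : ∀ᶠ ε : ℝ in nhdsWithin 0 (Set.Ioi 0),
        ∀ t t' : Fin (n + 1), t < t' → c₀ t + ε < c₀ t' - ε := by
      rw [Filter.eventually_all]
      intro t
      rw [Filter.eventually_all]
      intro t'
      by_cases htt : t < t'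
      · have hlt : c₀ t < c₀ t' := c₀.strictMono htt
        filter_upwards [Ioo_mem_nhdsGT (show (0 : ℝ) < (c₀ t' - c₀ t) / 2 by linarith)] with ε hε _
        linarith [hε.2]
      · exact Filter.Eventually.of_forall fun ε h => (htt h).elim
    obtain ⟨ε, h1, h2⟩ := (hev.and self_mem_nhdsWithin).exists
    exact ⟨ε, h2, h1⟩
  -- Removing the `ε`-neighbourhoods of the `n + 1` oscillation points leaves `n + 2` gaps; the two
  -- outer ones are cut to length `1`.
  let l : Fin (n + 2) → ℝ := Fin.cons (c₀ 0 - ε - 1) fun t => c₀ t + ε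
  let r : Fin (n + 2) → ℝ := Fin.snoc (α := fun _ => ℝ) (fun t => c₀ t - ε) (c₀ (Fin.last n) + ε + 1)
  have hlr : ∀ t, l t < r t := by
    intro t
    induction t using Fin.cases with
    | zero =>
      have : r 0 = c₀ 0 - ε := by
        rw [← Fin.castSucc_zero]; exact Fin.snoc_castSucc (α := fun _ => ℝ) _ _ _
      rw [this]; simp [l]
    | succ t =>
      have hl : l t.succ = c₀ t + ε := Fin.cons_succ _ _ _
      rw [hl]
      induction t using Fin.lastCases with
      | last =>
        have : r (Fin.last n).succ = c₀ (Fin.last n) + ε + 1 := by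
          rw [Fin.succ_last]; exact Fin.snoc_last (α := fun _ => ℝ) _ _
        rw [this]; linarith
      | cast t =>
        have : r t.castSucc.succ = c₀ t.succ - ε := by
          rw [Fin.succ_castSucc]; exact Fin.snoc_castSucc (α := fun _ => ℝ) _ _ _
        rw [this]; exact hgap _ _ Fin.castSucc_lt_succ
  choose D c hD hDc using fun t => exists_strictMono_homogeneous f (hlr t)
  have he : ∀ t : Fin (n + 1), ∃ e : ℚ, |(e : ℝ) - c₀ t| < ε ∧ ¬ (f e ↔ c t.castSucc) := by
    intro t
    obtain ⟨i, j, h1, h2, h3, h4⟩ := hc₀ t ε hε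
    by_cases hct : c t.castSucc
    · exact ⟨j, h2, by simp [hct, h4]⟩
    · exact ⟨i, h1, by simp [hct, h3]⟩
  choose e he he' using he
  refine ⟨D, c, e, hD, fun t k => (hDc t k).2.2, he', fun t k => ?_, fun t k => ?_⟩
  · have h1 := (hDc t.castSucc k).2.1
    have h2 : r t.castSucc = c₀ t - ε := Fin.snoc_castSucc (α := fun _ => ℝ) _ _ _
    have h3 := (abs_lt.1 (he t)).1
    have : (D t.castSucc k : ℝ) < e t := by linarith
    exact_mod_cast this
  · have h1 := (hDc t.succ k).1
    have h2 : l t.succ = c₀ t + ε := Fin.cons_succ _ _ _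
    have h3 := (abs_lt.1 (he t)).2
    have : (e t : ℝ) < D t.succ k := by linarith
    exact_mod_cast this

/-- If `f : ℚ → Prop` oscillates at more than `n` points, then it induces at least `m ^ (n + 1)`
patterns on increasing sequences of length `(n + 1) * m`. -/
theorem exists_patterns_of_oscillationSet (f : ℚ → Prop) (n m : ℕ)
    (h : ¬ (oscillationSet f).encard ≤ n) :
    ∃ g : (Fin (n + 1) → Fin m) → Fin ((n + 1) * m) → ℚ, (∀ s, StrictMono (g s)) ∧
      ∀ s s', (∀ i, f (g s i) ↔ f (g s' i)) → s = s' := by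
  obtain ⟨D, c, e, hD, hc, he, hDe, heD⟩ := exists_blocks_of_oscillationSet f n h
  -- Row `t` follows block `t` before column `s t`, takes the exceptional point `e t` there, and
  -- follows block `t + 1` afterwards. The shift by `m` keeps a row's use of its left block beyond
  -- the terms that the previous row takes from the same block.
  let G : (Fin (n + 1) → Fin m) → Fin (n + 1) ×ₗ Fin m → ℚ := fun s i =>
    if (ofLex i).2 < s (ofLex i).1 then D (ofLex i).1.castSucc (m + (ofLex i).2)
    else if (ofLex i).2 = s (ofLex i).1 then e (ofLex i).1
    else D (ofLex i).1.succ (ofLex i).2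
  have hlt : ∀ s t o, o < s t → G s (toLex (t, o)) = D t.castSucc (m + o) := by
    intro s t o h; simp [G, h]
  have heq : ∀ s t, G s (toLex (t, s t)) = e t := by
    intro s t; simp [G]
  have hgt : ∀ s t o, s t < o → G s (toLex (t, o)) = D t.succ o := by
    intro s t o h; simp [G, h.not_gt, h.ne']
  have hup : ∀ s t o, G s (toLex (t, o)) ≤ D t.succ o := by
    intro s t o
    rcases lt_trichotomy o (s t) with h | rfl | h
    · rw [hlt s t o h]; exact ((hDe t _).trans (heD t _)).le
    · rw [heq]; exact (heD t _).le
    · rw [hgt s t o h]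
  have hdown : ∀ s t (o : Fin m), D t.castSucc (m + (o : ℕ)) ≤ G s (toLex (t, o)) := by
    intro s t o
    rcases lt_trichotomy o (s t) with h | rfl | h
    · rw [hlt s t o h]
    · rw [heq]; exact (hDe t _).le
    · rw [hgt s t o h]; exact ((hDe t _).trans (heD t _)).le
  have hDD : ∀ t t' : Fin (n + 2), t < t' → ∀ k k', D t k < D t' k' := by
    intro t t' htt'
    induction t' using Fin.induction with
    | zero => exact absurd htt' (Fin.not_lt_zero _)
    | succ t' ih =>
      intro k k'
      rcases (Fin.le_castSucc_iff.2 htt').eq_or_lt with rfl | hlt'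
      · exact (hDe _ _).trans (heD _ _)
      · exact (ih hlt' k 0).trans ((hDe _ _).trans (heD _ _))
  have hG : ∀ s, StrictMono (G s) := by
    intro s i j hij
    obtain ⟨⟨t, o⟩, rfl⟩ := toLex.surjective i
    obtain ⟨⟨t', o'⟩, rfl⟩ := toLex.surjective j
    rcases Prod.Lex.toLex_lt_toLex.1 hij with htt | ⟨htt, hoo⟩
    · refine (hup s t o).trans_lt (lt_of_lt_of_le ?_ (hdown s t' o'))
      rcases (Fin.succ_le_castSucc_iff.2 htt).eq_or_lt with h | h
      · rw [h]; exact hD _ (by omega)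
      · exact hDD _ _ h _ _
    · obtain rfl : t = t' := htt
      replace hoo : o < o' := hoo
      rcases lt_trichotomy o (s t) with h1 | rfl | h1
      · rw [hlt s t o h1]
        rcases lt_trichotomy o' (s t) with h2 | rfl | h2
        · rw [hlt s t o' h2]; exact hD _ (by omega)
        · rw [heq]; exact hDe _ _
        · rw [hgt s t o' h2]; exact (hDe t _).trans (heD t _)
      · rw [heq, hgt s t o' hoo]; exact heD _ _
      · rw [hgt s t o h1, hgt s t o' (h1.trans hoo)]; exact hD _ hoo
  have hinj : ∀ s s', (∀ i, f (G s i) ↔ f (G s' i)) → s = s' := by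
    -- If `s t < s' t`, then at column `s t` the first pattern reads `e t` and the second a term of
    -- block `t`, where `f` differs.
    have key : ∀ s s', (∀ i, f (G s i) ↔ f (G s' i)) → ∀ t, s' t ≤ s t := by
      intro s s' hss t
      by_contra! hcon
      have h1 := hss (toLex (t, s t))
      rw [heq, hlt s' t _ hcon, hc] at h1
      exact he t h1
    intro s s' hss
    funext t
    exact le_antisymm (key s' s (fun i => (hss i).symm) t) (key s s' hss t)
  have hcard : Fintype.card (Fin (n + 1) ×ₗ Fin m) = (n + 1) * m := by
    rw [Fintype.card_lex]; simp
  let ι := Fintype.orderIsoFinOfCardEq (Fin (n + 1) ×ₗ Fin m) hcard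
  refine ⟨fun s => G s ∘ ι, fun s => (hG s).comp ι.strictMono, fun s s' hss => hinj s s' fun i => ?_⟩
  have := hss (ι.symm i)
  simpa using this

end Alternation

/-! ### From density to local dp-rank -/

theorem not_forall_pow_succ_le (n : ℕ) {ℓ : ℝ} (hℓ : ℓ < n + 1) (K : ℝ) :
    ∃ m : ℕ, 0 < m ∧ K * (((n + 1) * m : ℕ) : ℝ) ^ ℓ < (m : ℝ) ^ (n + 1) := by
  have ht : Filter.Tendsto (fun m : ℕ => (m : ℝ) ^ ((n : ℝ) + 1 - ℓ)) Filter.atTop Filter.atTop :=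
    (tendsto_rpow_atTop (by linarith)).comp tendsto_natCast_atTop_atTop
  obtain ⟨m, hm, hm0⟩ := ((ht.eventually_gt_atTop (K * ((n : ℝ) + 1) ^ ℓ)).and
    (Filter.eventually_gt_atTop 0)).exists
  refine ⟨m, hm0, ?_⟩
  have hm' : (0 : ℝ) < m := by exact_mod_cast hm0
  have h1 : (m : ℝ) ^ (n + 1) = (m : ℝ) ^ ((n : ℝ) + 1 - ℓ) * (m : ℝ) ^ ℓ := by
    rw [← Real.rpow_add hm', ← Real.rpow_natCast]; congr 1; push_cast; ring
  have h2 : (((n + 1) * m : ℕ) : ℝ) ^ ℓ = ((n : ℝ) + 1) ^ ℓ * (m : ℝ) ^ ℓ := by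
    push_cast
    exact Real.mul_rpow (by positivity) hm'.le
  rw [h1, h2, ← mul_assoc]
  exact mul_lt_mul_of_pos_right hm (by positivity)

section

variable {L : FirstOrder.Language.{u, v}} {M : Type w} [L.Structure M] {α : Type x} {β : Type y}
  {φ : L.Formula (α ⊕ β)} {p : Set (L.Formula α)}

/-- The patterns arise on different subsequences, but by indiscernibility each gives a `φ`-type over
the single sequence `b_0, …, b_{N-1}`, and distinct patterns give distinct types. -/
theorem VCindDensityLE.localDpRankLE [Finite α] {n : ℕ} {ℓ : ℝ} (hℓ : ℓ < n + 1)
    (h : VCindDensityLE M φ p ℓ) : LocalDpRankLE M φ p n := by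
  classical
  intro a ha b hb
  let f : ℚ → Prop := fun i => φ.Realize (Sum.elim a (b i))
  refine ⟨oscillationSet f, ?_, fun i j hij => iff_of_simC_oscillationSet f hij⟩
  by_contra hosc
  obtain ⟨K, hK⟩ := h
  obtain ⟨m, hm, hlt⟩ := not_forall_pow_succ_le n hℓ K
  obtain ⟨g, hg, hg'⟩ := exists_patterns_of_oscillationSet f n m hosc
  let N := (n + 1) * m
  let f₀ : Fin N → ℚ := fun i => (i : ℕ)
  have hf₀ : StrictMono f₀ := fun i j hij => by
    simp only [f₀]; exact_mod_cast hij
  let B : Fin N → β → M := fun i => b (f₀ i)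
  have hB : Indiscernible L B := fun k ψ f g hf hg =>
    hb k ψ (f₀ ∘ f) (f₀ ∘ g) (hf₀.comp hf) (hf₀.comp hg)
  let q : (Fin (n + 1) → Fin m) → Set ((β → M) × Bool) := fun s =>
    Set.range fun i => (b (f₀ i), decide (f (g s i)))
  have hq : ∀ s, q s ∈ phiTypes φ p (Set.range B) := by
    intro s
    refine mem_phiTypes_of_total ?_ (hb.consistentWith_of_strictMono ha hf₀ (hg s) _ fun i => ?_) ?_
    · rintro _ ⟨i, rfl⟩; exact ⟨i, rfl⟩
    · simp [f]
    · rintro _ ⟨i, rfl⟩; exact ⟨_, i, rfl⟩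
  have hqinj : Function.Injective fun s => (⟨q s, hq s⟩ : phiTypes φ p (Set.range B)) := by
    intro s s' hss
    have hss : q s = q s' := congrArg Subtype.val hss
    refine hg' s s' fun i => ?_
    have h1 : (b (f₀ i), decide (f (g s i))) ∈ q s' := hss ▸ ⟨i, rfl⟩
    have h2 : (b (f₀ i), decide (f (g s' i))) ∈ q s' := ⟨i, rfl⟩
    simpa using (hq s').1.2.sign_unique h1 h2
  have hfin : Finite (phiTypes φ p (Set.range B)) := finite_phiTypes (Set.finite_range B)
  have hcard := Nat.card_le_card_of_injective _ hqinj
  rw [Nat.card_eq_fintype_card (α := Fin (n + 1) → Fin m)] at hcard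
  simp only [Fintype.card_fun, Fintype.card_fin] at hcard
  have hle := hK N (by positivity) B hB
  rw [Set.ncard_def, Set.encard] at hle
  have hcard' : ((m : ℝ) ^ (n + 1)) ≤ (Nat.card (phiTypes φ p (Set.range B)) : ℝ) := by
    exact_mod_cast hcard
  exact absurd (hcard'.trans hle) (not_le.2 hlt)

end

/-! ### Finitary form of local dp-rank -/

section Compactness

variable {L : FirstOrder.Language.{u, v}} {M : Type w} [L.Structure M] {α : Type x} {β : Type y}
  {φ : L.Formula (α ⊕ β)} {p : Set (L.Formula α)}

/-- Indiscernibility with respect to the formulas in `Δ` of the restriction of `b` to `Q`. -/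
def IndiscernibleOn (Δ : Set (Σ m : ℕ, L.Formula (Fin m × β))) (Q : Set ℚ) (b : ℚ → β → M) :
    Prop :=
  ∀ θ ∈ Δ, ∀ f g : Fin θ.1 → ℚ, StrictMono f → StrictMono g → (∀ i, f i ∈ Q) → (∀ i, g i ∈ Q) →
    (θ.2.Realize (fun v => b (f v.1) v.2) ↔ θ.2.Realize (fun v => b (g v.1) v.2))

/-- A change between `2t` and `2t + 1` needs a point of `C` in `[2t, 2t + 1]`, and these `n + 1`
intervals are disjoint. -/
theorem LocalDpRankLE.exists_iff {n : ℕ} (h : LocalDpRankLE M φ p n) {a : α → M}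
    (ha : Realizes p a) {b : ℚ → β → M} (hb : Indiscernible L b) :
    ∃ t ≤ n, (φ.Realize (Sum.elim a (b ((2 * t : ℕ) : ℚ))) ↔
      φ.Realize (Sum.elim a (b ((2 * t + 1 : ℕ) : ℚ)))) := by
  by_contra! hcon
  obtain ⟨C, hC, hsim⟩ := h a ha b hb
  have hex : ∀ t : Fin (n + 1), ∃ c ∈ C, ((2 * t : ℕ) : ℝ) ≤ c ∧ c ≤ ((2 * t + 1 : ℕ) : ℝ) := by
    intro t
    by_contra! hno
    have hns : ¬ (φ.Realize (Sum.elim a (b ((2 * t : ℕ) : ℚ))) ↔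
      φ.Realize (Sum.elim a (b ((2 * t + 1 : ℕ) : ℚ)))) := by
      have := hcon t (by omega)
      tauto
    refine hns (hsim _ _ fun c hc => ?_)
    have hlt : ((2 * t : ℕ) : ℝ) < ((2 * t + 1 : ℕ) : ℝ) := by exact_mod_cast Nat.lt_succ_self _
    simp only [Rat.cast_natCast]
    rcases lt_or_ge c ((2 * t : ℕ) : ℝ) with h1 | h1
    · exact ⟨⟨fun _ => (h1.trans hlt).le, fun _ => h1.le⟩,
        ⟨fun h2 => absurd h1 h2.not_gt, fun h2 => absurd (h1.trans hlt) h2.not_gt⟩⟩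
    · have h2 := hno c hc h1
      exact ⟨⟨fun h3 => absurd (h2.trans_le h3) hlt.not_gt, fun h3 => absurd h2 h3.not_gt⟩,
        ⟨fun _ => h2.le, fun _ => h1⟩⟩
  choose c hcC hc1 hc2 using hex
  have hinj : Function.Injective c := by
    have key : ∀ t t' : Fin (n + 1), t < t' → c t ≠ c t' := by
      intro t t' htt
      have h3 : ((2 * t + 1 : ℕ) : ℝ) < ((2 * t' : ℕ) : ℝ) := by
        have h4 : (t : ℕ) < t' := htt
        exact_mod_cast (show 2 * (t : ℕ) + 1 < 2 * t' by omega)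
      exact (((hc2 t).trans_lt h3).trans_le (hc1 t')).ne
    intro t t' htt
    by_contra hne
    rcases lt_or_gt_of_ne hne with h1 | h1
    · exact key _ _ h1 htt
    · exact key _ _ h1 htt.symm
  have hle : (Set.range c).encard ≤ C.encard :=
    Set.encard_le_encard (by rintro _ ⟨t, rfl⟩; exact hcC t)
  rw [← Set.image_univ, hinj.encard_image, Set.encard_univ, ENat.card_eq_coe_fintype_card,
    Fintype.card_fin] at hle
  have := hle.trans hC
  norm_cast at this
  omega

/-- By compactness, local dp-rank at most `n` is witnessed by finitely many formulas. -/
theorem LocalDpRankLE.exists_finset {κ : Cardinal.{w}} (hκ : ℵ₀ < κ) (hM : IsSaturated L M κ)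
    [Finite α] [Finite β] {n : ℕ} (h : LocalDpRankLE M φ p n) :
    ∃ (Q : Finset ℚ) (Δ : Finset (Σ m : ℕ, L.Formula (Fin m × β))) (p₀ : Finset (L.Formula α)),
      (p₀ : Set (L.Formula α)) ⊆ p ∧ ∀ (a : α → M) (b : ℚ → β → M), (∀ ψ ∈ p₀, ψ.Realize a) →
        IndiscernibleOn (Δ : Set (Σ m : ℕ, L.Formula (Fin m × β))) (Q : Set ℚ) b →
        ∃ t ≤ n, (φ.Realize (Sum.elim a (b ((2 * t : ℕ) : ℚ))) ↔
          φ.Realize (Sum.elim a (b ((2 * t + 1 : ℕ) : ℚ)))) := by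
  classical
  by_contra! hcon
  let ind : ∀ θ : Σ m : ℕ, L.Formula (Fin m × β), (Fin θ.1 → ℚ) → L.Formula (α ⊕ (ℚ × β)) :=
    fun θ f => θ.2.relabel fun v => Sum.inr (f v.1, v.2)
  let inst : ℕ → L.Formula (α ⊕ (ℚ × β)) :=
    fun s => φ.relabel (Sum.map id fun j => ((s : ℚ), j))
  have hind : ∀ θ f (v : α ⊕ (ℚ × β) → M),
      (ind θ f).Realize v ↔ θ.2.Realize (fun i => v (Sum.inr (f i.1, i.2))) := by
    intro θ f v
    rw [Language.Formula.realize_relabel]; rfl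
  have hinst : ∀ s (v : α ⊕ (ℚ × β) → M), (inst s).Realize v ↔
      φ.Realize (Sum.elim (fun i => v (Sum.inl i)) (fun j => v (Sum.inr ((s : ℚ), j)))) := by
    intro s v
    rw [Language.Formula.realize_relabel]
    have : v ∘ Sum.map id (fun j => ((s : ℚ), j)) =
        Sum.elim (fun i => v (Sum.inl i)) (fun j => v (Sum.inr ((s : ℚ), j))) := by
      funext i; cases i <;> rfl
    rw [this]
  -- A solution of `Γ` is a realization of `p` with an indiscernible sequence changing truth value
  -- at all `n + 1` pairs.
  let Γ : Set (L.Formula (α ⊕ (ℚ × β))) :=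
    {χ | (∃ ψ ∈ p, χ = ψ.relabel Sum.inl) ∨
      (∃ θ f g, StrictMono f ∧ StrictMono g ∧ χ = (ind θ f).iff (ind θ g)) ∨
      (∃ t ≤ n, χ = ((inst (2 * t)).iff (inst (2 * t + 1))).not)}
  have hsat : ∀ χ ∈ Γ, ∃ (Q : Finset ℚ) (Δ : Finset (Σ m : ℕ, L.Formula (Fin m × β)))
      (p₀ : Finset (L.Formula α)), (p₀ : Set (L.Formula α)) ⊆ p ∧
      ∀ v : α ⊕ (ℚ × β) → M, (∀ ψ ∈ p₀, ψ.Realize fun i => v (Sum.inl i)) →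
        IndiscernibleOn (Δ : Set (Σ m : ℕ, L.Formula (Fin m × β))) (Q : Set ℚ)
          (fun i j => v (Sum.inr (i, j))) →
        (∀ t ≤ n, ¬ ((inst (2 * t)).Realize v ↔ (inst (2 * t + 1)).Realize v)) →
        χ.Realize v := by
    rintro χ (⟨ψ, hψ, rfl⟩ | ⟨θ, f, g, hf, hg, rfl⟩ | ⟨t, ht, rfl⟩)
    · refine ⟨∅, ∅, {ψ}, by simpa using hψ, fun v h1 _ _ => ?_⟩
      rw [Language.Formula.realize_relabel]
      exact h1 ψ (by simp)
    · refine ⟨Finset.univ.image f ∪ Finset.univ.image g, {θ}, ∅, by simp, fun v _ h2 _ => ?_⟩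
      rw [Language.Formula.realize_iff, hind, hind]
      exact h2 θ (by simp) f g hf hg (fun i => by simp) (fun i => by simp)
    · refine ⟨∅, ∅, ∅, by simp, fun v _ _ h3 => ?_⟩
      rw [Language.Formula.realize_not, Language.Formula.realize_iff]
      exact h3 t ht
  obtain ⟨v, hv⟩ := hM.exists_realize hκ Γ (by
    intro Γ₀ hΓ₀
    choose! Q Δ p₀ h1 h2 using hsat
    obtain ⟨a, b, ha, hb, hab⟩ := hcon (Γ₀.biUnion Q) (Γ₀.biUnion Δ) (Γ₀.biUnion p₀) (by
      intro ψ hψ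
      obtain ⟨χ, hχ, hψ⟩ := Finset.mem_biUnion.1 (Finset.mem_coe.1 hψ)
      exact h1 χ (hΓ₀ hχ) hψ)
    refine ⟨Sum.elim a fun e => b e.1 e.2, fun χ hχ => h2 χ (hΓ₀ hχ) _ ?_ ?_ ?_⟩
    · intro ψ hψ
      exact ha ψ (Finset.mem_biUnion.2 ⟨χ, hχ, hψ⟩)
    · intro θ hθ f g hf hg hfQ hgQ
      exact hb θ (Finset.mem_coe.2 (Finset.mem_biUnion.2 ⟨χ, hχ, hθ⟩)) f g hf hg
        (fun i => Finset.mem_coe.2 (Finset.mem_biUnion.2 ⟨χ, hχ, hfQ i⟩))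
        (fun i => Finset.mem_coe.2 (Finset.mem_biUnion.2 ⟨χ, hχ, hgQ i⟩))
    · intro t ht
      rw [hinst, hinst]
      have := hab t ht
      simp only [Sum.elim_inl, Sum.elim_inr]
      tauto)
  obtain ⟨t, ht, hiff⟩ := h.exists_iff (a := fun i => v (Sum.inl i))
    (b := fun i j => v (Sum.inr (i, j)))
    (fun ψ hψ => by
      have := hv _ (Or.inl ⟨ψ, hψ, rfl⟩)
      rwa [Language.Formula.realize_relabel] at this)
    (fun m ψ f g hf hg => by
      have := hv _ (Or.inr (Or.inl ⟨⟨m, ψ⟩, f, g, hf, hg, rfl⟩))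
      rwa [Language.Formula.realize_iff, hind, hind] at this)
  have := hv _ (Or.inr (Or.inr ⟨t, ht, rfl⟩))
  rw [Language.Formula.realize_not, Language.Formula.realize_iff, hinst, hinst] at this
  exact this hiff

end Compactness

/-! ### Combinatorics of indices -/

section Combinatorics

/-- Widely separated prescribed values at `0, …, K` extend to a map `ℚ → ℕ` that is strictly
increasing on a given finite set. -/
theorem exists_strictMonoOn_extension (Q : Finset ℚ) {d K : ℕ} (hd : Q.card ≤ d) (P : ℕ → ℕ)
    (hP : ∀ s < K, P s + d ≤ P (s + 1)) (hP0 : d ≤ P 0) :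
    ∃ e : ℚ → ℕ, StrictMonoOn e Q ∧ (∀ s ≤ K, e (s : ℚ) = P s) ∧ ∀ q, e q ≤ P K + d := by
  classical
  let c : ℚ → ℕ := fun q => (Q.filter (· < q)).card
  have hc : ∀ q, c q ≤ d := fun q => (Finset.card_filter_le _ _).trans hd
  have hcmono : Monotone c := fun q q' h => Finset.card_le_card
    (Finset.monotone_filter_right _ fun r _ hr => lt_of_lt_of_le hr h)
  have hcstrict : ∀ q ∈ Q, ∀ q', q < q' → c q < c q' := by
    intro q hq q' h
    refine Finset.card_lt_card ((Finset.ssubset_iff_of_subset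
      (Finset.monotone_filter_right _ fun r _ hr => lt_trans hr h)).2 ⟨q, ?_, ?_⟩)
    · simp [hq, h]
    · simp
  have hge : ∀ s ≤ K, d ≤ P s := by
    intro s hs
    induction s with
    | zero => exact hP0
    | succ s ih => have := ih (by omega); have := hP s (by omega); omega
  -- The extension is `H ⌊q⌋₊ + c q`. The count `c` makes it strict on `Q`; subtracting `c s`
  -- restores the value `P s` at integers, and gaps of size `d ≥ c` keep `H` monotone.
  let H : ℕ → ℕ := fun s => P (min s K) - c ((min s K : ℕ) : ℚ)
  have hH : Monotone H := by
    refine monotone_nat_of_le_succ fun s => ?_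
    simp only [H]
    by_cases hs : s < K
    · rw [min_eq_left hs.le, min_eq_left (show s + 1 ≤ K by omega)]
      have := hP s hs
      have := hc ((s + 1 : ℕ) : ℚ)
      omega
    · rw [min_eq_right (by omega), min_eq_right (by omega)]
  refine ⟨fun q => H ⌊q⌋₊ + c q, ?_, ?_, ?_⟩
  · intro q hq q' _ h
    exact Nat.add_lt_add_of_le_of_lt (hH (Nat.floor_mono h.le)) (hcstrict q hq q' h)
  · intro s hs
    have h1 := hge s hs
    have h2 := hc (s : ℚ)
    simp only [H, Nat.floor_natCast, min_eq_left hs]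
    omega
  · intro q
    have h1 : H ⌊q⌋₊ ≤ P K := by
      refine (hH (le_max_left _ K)).trans ?_
      simp only [H]
      rw [min_eq_right (le_max_right _ _)]
      omega
    exact Nat.add_le_add h1 (hc q)

/-- A set of natural numbers either contains `n + 1` points with gaps larger than `g`, or is covered
by `n` intervals of length `g` starting at some of its points. -/
theorem exists_separated_or_cover (g n : ℕ) {N : ℕ} (hN : 0 < N) (S : Set ℕ) (hS : ∀ i ∈ S, i < N) :
    (∃ x : ℕ → ℕ, (∀ t ≤ n, x t ∈ S) ∧ ∀ t < n, x t + g < x (t + 1)) ∨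
      ∃ x : Fin n → Fin N, ∀ i ∈ S, ∃ t, (x t : ℕ) ≤ i ∧ i ≤ x t + g := by
  classical
  rcases S.eq_empty_or_nonempty with rfl | hne
  · exact Or.inr ⟨fun _ => ⟨0, hN⟩, by simp⟩
  induction n generalizing S with
  | zero =>
    obtain ⟨i, hi⟩ := hne
    exact Or.inl ⟨fun _ => i, fun _ _ => hi, by simp⟩
  | succ n ih =>
    obtain ⟨i₀, hi₀, hmin⟩ : ∃ i₀ ∈ S, ∀ i ∈ S, i₀ ≤ i :=
      ⟨sInf S, Nat.sInf_mem hne, fun i hi => Nat.sInf_le hi⟩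
    -- Greedy choice: the least element starts an interval, and induction treats what lies beyond
    -- it.
    let S' : Set ℕ := {i ∈ S | i₀ + g < i}
    rcases S'.eq_empty_or_nonempty with hS' | hS'
    · refine Or.inr ⟨fun _ => ⟨i₀, hS _ hi₀⟩, fun i hi => ⟨0, hmin i hi, ?_⟩⟩
      by_contra! hlt
      exact (Set.eq_empty_iff_forall_notMem.1 hS') i ⟨hi, hlt⟩
    · rcases ih S' (fun i hi => hS i hi.1) hS' with ⟨x, hx, hx'⟩ | ⟨x, hx⟩
      · refine Or.inl ⟨fun t => t.casesOn i₀ x, ?_, ?_⟩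
        · rintro (_ | t) ht
          · exact hi₀
          · exact (hx t (by omega)).1
        · rintro (_ | t) ht
          · exact (hx 0 (by omega)).2
          · exact hx' t (by omega)
      · refine Or.inr ⟨Fin.cons ⟨i₀, hS _ hi₀⟩ x, fun i hi => ?_⟩
        by_cases hlt : i₀ + g < i
        · obtain ⟨t, ht⟩ := hx i ⟨hi, hlt⟩
          exact ⟨t.succ, by simpa using ht⟩
        · exact ⟨0, by simpa using ⟨hmin i hi, not_lt.1 hlt⟩⟩

theorem exists_fin_cover {n N : ℕ} (hN : 0 < N) (E : Finset (Fin N)) (hE : E.card ≤ n) :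
    ∃ x : Fin n → Fin N, ∀ i ∈ E, ∃ t, x t = i := by
  refine ⟨fun t => if h : (t : ℕ) < E.card then (E.equivFin.symm ⟨t, h⟩).1 else ⟨0, hN⟩,
    fun i hi => ⟨⟨E.equivFin ⟨i, hi⟩, (E.equivFin ⟨i, hi⟩).2.trans_le hE⟩, ?_⟩⟩
  simp

end Combinatorics

/-! ### Symmetric formulas and Boolean combinations -/

section Symmetry

variable {L : FirstOrder.Language.{u, v}} {M : Type w} [L.Structure M] {β : Type y}

/-- On an indiscernible sequence, a formula is either symmetric or sensitive to the exchange of two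
adjacent elements. -/
theorem Indiscernible.symmetric_or_swap {I : Type*} [LinearOrder I] {b : I → β → M}
    (hb : Indiscernible L b) {m : ℕ} (θ : L.Formula (Fin m × β)) :
    (∀ f g : Fin m → I, Function.Injective f → Function.Injective g →
      (θ.Realize (fun v => b (f v.1) v.2) ↔ θ.Realize (fun v => b (g v.1) v.2))) ∨
    ∃ (σ : Equiv.Perm (Fin m)) (r r' : Fin m), (r' : ℕ) = r + 1 ∧ ∀ f g : Fin m → I,
      StrictMono f → StrictMono g → ¬ (θ.Realize (fun v => b (f (σ v.1)) v.2) ↔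
        θ.Realize (fun v => b (g (Equiv.swap r r' (σ v.1))) v.2)) := by
  classical
  have hperm : ∀ (σ : Equiv.Perm (Fin m)) (f g : Fin m → I), StrictMono f → StrictMono g →
      (θ.Realize (fun v => b (f (σ v.1)) v.2) ↔ θ.Realize (fun v => b (g (σ v.1)) v.2)) := by
    intro σ f g hf hg
    have := hb m (θ.relabel fun v => (σ v.1, v.2)) f g hf hg
    rwa [Language.Formula.realize_relabel, Language.Formula.realize_relabel] at this
  refine or_iff_not_imp_right.2 fun hcon => ?_
  push Not at hcon
  have hswap : ∀ (σ : Equiv.Perm (Fin m)) (r r' : Fin m), (r' : ℕ) = r + 1 →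
      ∀ f : Fin m → I, StrictMono f → (θ.Realize (fun v => b (f (σ v.1)) v.2) ↔
        θ.Realize (fun v => b (f (Equiv.swap r r' (σ v.1))) v.2)) := by
    intro σ r r' hr f hf
    obtain ⟨f', g', hf', hg', h⟩ := hcon σ r r' hr
    rw [hperm σ f f' hf hf', h]
    exact hperm (Equiv.swap r r' * σ) g' f hg' hf
  -- Adjacent transpositions generate the symmetric group, so invariance under them gives invariance
  -- under every permutation.
  have hall : ∀ (τ : Equiv.Perm (Fin m)) (f : Fin m → I), StrictMono f →
      (θ.Realize (fun v => b (f (τ v.1)) v.2) ↔ θ.Realize (fun v => b (f v.1) v.2)) := by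
    intro τ f hf
    cases m with
    | zero =>
      have : τ = 1 := Subsingleton.elim _ _
      rw [this]; rfl
    | succ m =>
      have hτ : τ ∈ Submonoid.closure
          (Set.range fun i : Fin m => Equiv.swap i.castSucc i.succ) := by
        rw [Equiv.Perm.mclosure_swap_castSucc_succ]; trivial
      induction hτ using Submonoid.closure_induction_left with
      | one => rfl
      | mul_left x hx y _ ih =>
        obtain ⟨i, rfl⟩ := hx
        exact (hswap y i.castSucc i.succ (by simp) f hf).symm.trans ih
  have hsort : ∀ f : Fin m → I, Function.Injective f → ∃ f' : Fin m → I, StrictMono f' ∧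
      (θ.Realize (fun v => b (f v.1) v.2) ↔ θ.Realize (fun v => b (f' v.1) v.2)) := by
    intro f hf
    have hmono : StrictMono (f ∘ Tuple.sort f) :=
      (Tuple.monotone_sort f).strictMono_of_injective (hf.comp (Tuple.sort f).injective)
    refine ⟨_, hmono, ?_⟩
    have := hall (Tuple.sort f)⁻¹ _ hmono
    simpa using this
  intro f g hf hg
  obtain ⟨f', hf', h1⟩ := hsort f hf
  obtain ⟨g', hg', h2⟩ := hsort g hg
  rw [h1, h2]
  exact hb m θ f' g' hf' hg'

/-- The Boolean combinations of finitely many formulas define every set that is a union of classes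
of the equivalence relation of satisfying the same of these formulas. -/
theorem exists_boolean_combinations (M : Type w) [L.Structure M] {γ H : Type*} [Finite H]
    (η : H → L.Formula (β ⊕ γ)) :
    ∃ (R : ℕ) (ψ : Fin R → L.Formula (β ⊕ γ)), ∀ (c : γ → M) (B : Set (β → M))
      (W : (β → M) → Prop), (∀ b ∈ B, ∀ b' ∈ B,
        (∀ h, (η h).Realize (Sum.elim b c) ↔ (η h).Realize (Sum.elim b' c)) → W b → W b') →
      ∃ r, ∀ b ∈ B, ((ψ r).Realize (Sum.elim b c) ↔ W b) := by
  classical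
  let χ : Set (H → Bool) → L.Formula (β ⊕ γ) := fun S =>
    Language.Formula.iSup fun τ : S => Language.Formula.iInf fun h =>
      if τ.1 h = true then η h else (η h).not
  obtain ⟨R, ⟨ε⟩⟩ := Finite.exists_equiv_fin (Set (H → Bool))
  refine ⟨R, fun r => χ (ε.symm r), fun c B W hW => ?_⟩
  let S : Set (H → Bool) := {τ | ∃ b ∈ B, W b ∧ ∀ h, ((η h).Realize (Sum.elim b c) ↔ τ h = true)}
  refine ⟨ε S, fun b hb => ?_⟩
  have hη : ∀ (τ : H → Bool) h, (if τ h = true then η h else (η h).not).Realize (Sum.elim b c) ↔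
      ((η h).Realize (Sum.elim b c) ↔ τ h = true) := by
    intro τ h
    cases τ h <;> simp [Language.Formula.realize_not]
  have hχ : (χ S).Realize (Sum.elim b c) ↔
      ∃ τ ∈ S, ∀ h, ((η h).Realize (Sum.elim b c) ↔ τ h = true) := by
    simp only [χ, Language.Formula.realize_iSup, Language.Formula.realize_iInf, hη,
      Subtype.exists, exists_prop]
  change (χ (ε.symm (ε S))).Realize _ ↔ _
  rw [Equiv.symm_apply_apply, hχ]
  constructor
  · rintro ⟨τ, ⟨b', hb', hWb', hτ'⟩, hτ⟩
    exact hW b' hb' b hb (fun h => (hτ' h).trans (hτ h).symm) hWb'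
  · intro hWb
    exact ⟨fun h => decide ((η h).Realize (Sum.elim b c)), ⟨b, hb, hWb, by simp⟩, by simp⟩

end Symmetry

/-! ### Truth values along finite indiscernible sequences -/

section FiniteSequences

variable {L : FirstOrder.Language.{u, v}} {M : Type w} [L.Structure M] {β : Type y}
  {Q : Finset ℚ} {Δ : Finset (Σ m : ℕ, L.Formula (Fin m × β))} {n N : ℕ} {b : Fin N → β → M}
  {W : Fin N → Prop}

/-- If the formulas in `Δ` are symmetric on `b`, then a property of the indices without too many
alternations is finite or cofinite, uniformly. -/
theorem card_filter_le_of_symmetric [DecidablePred W]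
    (hsym : ∀ θ ∈ Δ, ∀ f g : Fin θ.1 → Fin N, Function.Injective f → Function.Injective g →
      (θ.2.Realize (fun v => b (f v.1) v.2) ↔ θ.2.Realize (fun v => b (g v.1) v.2)))
    (hW : ∀ e : ℚ → Fin N,
      IndiscernibleOn (Δ : Set (Σ m : ℕ, L.Formula (Fin m × β))) (Q : Set ℚ) (fun q => b (e q)) →
        ∃ t ≤ n, (W (e ((2 * t : ℕ) : ℚ)) ↔ W (e ((2 * t + 1 : ℕ) : ℚ))))
    (hN : (Q.card + 1) * (2 * n + 3) < N) :
    (Finset.univ.filter W).card ≤ n ∨ (Finset.univ.filter fun i => ¬ W i).card ≤ n := by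
  classical
  by_contra! hcon
  obtain ⟨hT, hF⟩ := hcon
  obtain ⟨T, hT, hTc⟩ := Finset.exists_subset_card_eq (Nat.succ_le_of_lt hT)
  obtain ⟨F, hF, hFc⟩ := Finset.exists_subset_card_eq (Nat.succ_le_of_lt hF)
  let u := T.orderEmbOfFin hTc
  let v := F.orderEmbOfFin hFc
  have hu : ∀ t, W (u t) := fun t =>
    (Finset.mem_filter.1 (hT (Finset.orderEmbOfFin_mem T hTc t))).2
  have hv : ∀ t, ¬ W (v t) := fun t =>
    (Finset.mem_filter.1 (hF (Finset.orderEmbOfFin_mem F hFc t))).2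
  -- Using `Q.card + 1` rather than `Q.card` keeps the prescribed values distinct even for empty
  -- `Q`; the bound on `e` is then `(Q.card + 1) * (2 * n + 3)`.
  obtain ⟨e, he, heP, heN⟩ := exists_strictMonoOn_extension Q (d := Q.card + 1) (K := 2 * n + 1)
    (Nat.le_succ _) (fun s => (Q.card + 1) * (s + 1)) (fun s _ => by simp only [mul_add]; omega)
    (by simp)
  have heN' : ∀ q, e q < N := by
    intro q
    refine (heN q).trans_lt (lt_of_eq_of_lt ?_ hN)
    ring
  let X : Fin (2 * n + 2) ↪ Fin N := ⟨fun s => ⟨e ((s : ℕ) : ℚ), heN' _⟩, by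
    intro s s' h
    have h : e ((s : ℕ) : ℚ) = e ((s' : ℕ) : ℚ) := congrArg Fin.val h
    rw [heP _ (by omega), heP _ (by omega)] at h
    have := Nat.eq_of_mul_eq_mul_left (Nat.succ_pos _) h
    omega⟩
  let Y : Fin (2 * n + 2) ↪ Fin N := ⟨fun s =>
    if (s : ℕ) % 2 = 0 then u ⟨s / 2, by omega⟩ else v ⟨s / 2, by omega⟩, by
    intro s s' h
    simp only at h
    split_ifs at h with h1 h2 h2
    · have := congrArg Fin.val (u.injective h); simp only at this; omega
    · exact (hv _ (h ▸ hu _)).elim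
    · exact (hv _ (h ▸ hu _)).elim
    · have := congrArg Fin.val (v.injective h); simp only at this; omega⟩
  have := Equiv.Perm.isMultiplyPretransitive (Fin N) (2 * n + 2)
  -- `Y` alternates between places where `W` holds and fails. A permutation carrying `X` to `Y` may
  -- destroy the order, but symmetric formulas do not notice.
  obtain ⟨π, hπ⟩ := MulAction.exists_smul_eq (Equiv.Perm (Fin N)) X Y
  have hπ' : ∀ s, π (X s) = Y s := fun s => by rw [← hπ]; rfl
  obtain ⟨t, ht, hiff⟩ := hW (fun q => π ⟨e q, heN' q⟩) (by
    intro θ hθ f g hf hg hfQ hgQ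
    have hinj : ∀ f : Fin θ.1 → ℚ, StrictMono f → (∀ i, f i ∈ (Q : Set ℚ)) →
        Function.Injective fun i => π ⟨e (f i), heN' (f i)⟩ := by
      intro f hf hfQ i i' h
      have h : e (f i) = e (f i') := congrArg Fin.val (π.injective h)
      exact hf.injective (he.injOn (hfQ i) (hfQ i') h)
    exact hsym θ hθ _ _ (hinj f hf hfQ) (hinj g hg hgQ))
  have h1 : π ⟨e ((2 * t : ℕ) : ℚ), heN' _⟩ = u ⟨t, by omega⟩ := by
    refine (hπ' ⟨2 * t, by omega⟩).trans ?_
    simp [Y]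
  have h2 : π ⟨e ((2 * t + 1 : ℕ) : ℚ), heN' _⟩ = v ⟨t, by omega⟩ := by
    refine (hπ' ⟨2 * t + 1, by omega⟩).trans ?_
    have h3 : (2 * t + 1) / 2 = t := by omega
    simp [Y, h3]
  rw [h1, h2] at hiff
  exact hv _ (hiff.1 (hu _))

/-- The places, away from the ends, where a property of the indices without too many alternations
changes its value are covered by few short intervals. -/
theorem Indiscernible.exists_windows (hb : Indiscernible L b)
    (hW : ∀ e : ℚ → Fin N,
      IndiscernibleOn (Δ : Set (Σ m : ℕ, L.Formula (Fin m × β))) (Q : Set ℚ) (fun q => b (e q)) →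
        ∃ t ≤ n, (W (e ((2 * t : ℕ) : ℚ)) ↔ W (e ((2 * t + 1 : ℕ) : ℚ))))
    {d D : ℕ} (hd : Q.card ≤ d) (hD : 2 * d ≤ D) (hN : 0 < N) :
    ∃ x : Fin n → Fin N, ∀ (i : ℕ) (hi : i + 1 < N), D ≤ i → i + 1 + D < N →
      ¬ (W ⟨i, by omega⟩ ↔ W ⟨i + 1, hi⟩) → ∃ t, (x t : ℕ) ≤ i ∧ i ≤ x t + 2 * d := by
  classical
  let S : Set ℕ := {i | ∃ hi : i + 1 < N, D ≤ i ∧ i + 1 + D < N ∧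
    ¬ (W ⟨i, by omega⟩ ↔ W ⟨i + 1, hi⟩)}
  rcases exists_separated_or_cover (2 * d) n hN S (fun i hi => by obtain ⟨h, -⟩ := hi; omega) with
    ⟨x, hx, hx'⟩ | ⟨x, hx⟩
  swap
  · exact ⟨x, fun i hi h1 h2 h3 => hx i ⟨hi, h1, h2, h3⟩⟩
  exfalso
  -- Since `W` changes between `x t` and `x t + 1`, one of the two differs from `x t - d`. The pairs
  -- `x t - d`, `y t` then have all gaps at least `d`, as the `x t` are more than `2 * d` apart.
  have hy : ∀ t, ∃ y : ℕ, x t ≤ y ∧ y ≤ x t + 1 ∧ (t ≤ n → ∃ (h1 : x t - d < N) (h2 : y < N),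
      ¬ (W ⟨x t - d, h1⟩ ↔ W ⟨y, h2⟩)) := by
    intro t
    by_cases ht : t ≤ n
    · obtain ⟨h1, h2, h3, h4⟩ := hx t ht
      by_cases hc : W ⟨x t - d, by omega⟩ ↔ W ⟨x t, by omega⟩
      · exact ⟨x t + 1, by omega, le_rfl, fun _ => ⟨by omega, h1, by rwa [hc]⟩⟩
      · exact ⟨x t, le_rfl, by omega, fun _ => ⟨by omega, by omega, hc⟩⟩
    · exact ⟨x t, le_rfl, by omega, fun h => (ht h).elim⟩
  choose y hy1 hy2 hy3 using hy
  let P : ℕ → ℕ := fun s => if s % 2 = 0 then x (s / 2) - d else y (s / 2)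
  have hPe : ∀ t, P (2 * t) = x t - d := by
    intro t
    simp [P]
  have hPo : ∀ t, P (2 * t + 1) = y t := by
    intro t
    have h1 : (2 * t + 1) / 2 = t := by omega
    simp [P, h1]
  obtain ⟨e, he, heP, heN⟩ := exists_strictMonoOn_extension Q (d := d) (K := 2 * n + 1) hd P
    (by
      intro s hs
      rcases Nat.even_or_odd' s with ⟨t, rfl | rfl⟩
      · rw [hPe, hPo]
        obtain ⟨h1, h2, h3, h4⟩ := hx t (by omega)
        have := hy1 t
        omega
      · rw [hPo, show 2 * t + 1 + 1 = 2 * (t + 1) by ring, hPe]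
        have := hx' t (by omega)
        have := hy2 t
        omega)
    (by
      rw [show (0 : ℕ) = 2 * 0 from rfl, hPe]
      obtain ⟨h1, h2, h3, h4⟩ := hx 0 (by omega)
      omega)
  have heN' : ∀ q, e q < N := by
    intro q
    have h := heN q
    rw [hPo] at h
    obtain ⟨h1, h2, h3, h4⟩ := hx n le_rfl
    have := hy2 n
    omega
  obtain ⟨t, ht, hiff⟩ := hW (fun q => ⟨e q, heN' q⟩) (by
    intro θ hθ f g hf hg hfQ hgQ
    exact hb θ.1 θ.2 (fun i => ⟨e (f i), heN' _⟩) (fun i => ⟨e (g i), heN' _⟩)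
      (fun i j hij => he (hfQ i) (hfQ j) (hf hij)) (fun i j hij => he (hgQ i) (hgQ j) (hg hij)))
  obtain ⟨h1, h2, h3⟩ := hy3 t ht
  refine h3 ?_
  have e1 : (⟨e ((2 * t : ℕ) : ℚ), heN' _⟩ : Fin N) = ⟨x t - d, h1⟩ :=
    Fin.ext ((heP _ (by omega)).trans (hPe t))
  have e2 : (⟨e ((2 * t + 1 : ℕ) : ℚ), heN' _⟩ : Fin N) = ⟨y t, h2⟩ :=
    Fin.ext ((heP _ (by omega)).trans (hPo t))
  rwa [e1, e2] at hiff

/-- A formula sensitive to the exchange of two adjacent elements of an indiscernible sequence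
separates, with parameters from the ends of the sequence, the elements on the two sides of a given
one. -/
theorem exists_not_agree_of_swap {m D : ℕ} (hm : m ≤ D)
    {θ : L.Formula (Fin m × β)} {σ : Equiv.Perm (Fin m)} {r r' : Fin m} (hr : (r' : ℕ) = r + 1)
    (hswap : ∀ f g : Fin m → Fin N, StrictMono f → StrictMono g →
      ¬ (θ.Realize (fun v => b (f (σ v.1)) v.2) ↔
        θ.Realize (fun v => b (g (Equiv.swap r r' (σ v.1))) v.2)))
    {ι : Type*} {c : ι → β → M}
    (hends : ∀ u : Fin N, ((u : ℕ) < D ∨ N ≤ u + D) → ∃ k, c k = b u)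
    {j i j' : Fin N} (hj : D ≤ (j : ℕ)) (hji : j < i) (hij' : i < j') (hj' : (j' : ℕ) + D < N)
    {k : ι} (hk : c k = b i) :
    ∃ g : Fin m → Option ι, ¬ (θ.Realize (fun v => (g v.1).elim (b j) c v.2) ↔
      θ.Realize (fun v => (g v.1).elim (b j') c v.2)) := by
  classical
  -- `F s s'` puts `s`, `s'` at the adjacent positions `r`, `r'` and fills the rest from the two
  -- ends of the sequence.
  let F : Fin N → Fin N → Fin m → Fin N := fun s s' v =>
    if v < r then ⟨v, by omega⟩ else if v = r then s else if v = r' then s'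
      else ⟨N - m + v, by omega⟩
  have hF : ∀ s s' : Fin N, D ≤ (s : ℕ) → s < s' → (s' : ℕ) + D < N → StrictMono (F s s') := by
    intro s s' h1 h2 h3 v v' hvv
    have h2' : (s : ℕ) < s' := h2
    have hvv' : (v : ℕ) < v' := hvv
    simp only [F, Fin.lt_def, Fin.ext_iff]
    split_ifs <;> (try simp only) <;> omega
  have hrr : r ≠ r' := fun h => by rw [h] at hr; omega
  have hnlt : ¬ r' < r := by rw [Fin.lt_def]; omega
  have hFr : ∀ s s', F s s' r = s := fun s s' => by simp [F]
  have hFr' : ∀ s s', F s s' r' = s' := fun s s' => by simp [F, hnlt, hrr.symm]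
  -- After the swap, `F j i` agrees with `F i j'` except at `r'`, where they have `j` and `j'`;
  -- everything else is a parameter, and `none` marks the varying place.
  have hg : ∀ v : Fin m, ∃ o : Option ι,
      o.elim (b j) c = b (F j i (Equiv.swap r r' v)) ∧ o.elim (b j') c = b (F i j' v) := by
    intro v
    by_cases h1 : v = r
    · subst h1
      exact ⟨some k, by rw [Equiv.swap_apply_left, hFr', Option.elim_some, hk],
        by rw [hFr, Option.elim_some, hk]⟩
    by_cases h2 : v = r'
    · subst h2
      exact ⟨none, by rw [Equiv.swap_apply_right, hFr, Option.elim_none],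
        by rw [hFr', Option.elim_none]⟩
    have h3 : F i j' v = F j i v := by simp [F, h1, h2]
    obtain ⟨k', hk'⟩ := hends (F j i v) (by
      simp only [F, if_neg h1, if_neg h2]
      split_ifs <;> simp only <;> omega)
    exact ⟨some k', by rw [Equiv.swap_apply_of_ne_of_ne h1 h2, Option.elim_some, hk'],
      by rw [h3, Option.elim_some, hk']⟩
  choose g hg1 hg2 using hg
  refine ⟨fun v => g (σ v), fun hiff => ?_⟩
  simp only [hg1, hg2] at hiff
  exact hswap (F i j') (F j i) (hF _ _ (hj.trans hji.le) hij' hj')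
    (hF _ _ hj hji (lt_of_le_of_lt (Nat.add_le_add_right hij'.le D) hj')) hiff.symm

/-- The parameters for defining a property of the indices of a finite sequence: the elements of
`n` blocks, and the elements close to one of the two ends. -/
def blockParams (hN : 0 < N) (b : Fin N → β → M) {ℓ : ℕ} (D : ℕ) (x : Fin n → Fin N) :
    (Fin n × Fin (ℓ + 1)) ⊕ Fin (2 * D) → β → M :=
  Sum.elim (fun e => entry hN b ((x e.1 : ℕ) + (e.2 : ℕ)))
    (fun h => b (if (h : ℕ) < D then ⟨min h (N - 1), by omega⟩ else ⟨N - 1 - (h - D), by omega⟩))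

theorem exists_blockParams_eq (hN : 0 < N) (b : Fin N → β → M) {ℓ D : ℕ} (x : Fin n → Fin N)
    (u : Fin N) (hu : (u : ℕ) < D ∨ N ≤ u + D) :
    ∃ k, blockParams (ℓ := ℓ) hN b D x k = b u := by
  by_cases h : (u : ℕ) < D
  · refine ⟨Sum.inr ⟨u, by omega⟩, ?_⟩
    simp only [blockParams, Sum.elim_inr, if_pos h]
    congr 1
    ext
    simp only
    omega
  · refine ⟨Sum.inr ⟨D + (N - 1 - u), by omega⟩, ?_⟩
    have h' : ¬ D + (N - 1 - (u : ℕ)) < D := by omega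
    simp only [blockParams, Sum.elim_inr, if_neg h']
    congr 1
    ext
    simp only
    omega

/-- A property of the indices without too many alternations only depends on the equalities and
the instances of formulas in `Δ` that hold between an element and suitable parameters. -/
theorem Indiscernible.exists_blocks (hN : 0 < N) (hb : Indiscernible L b)
    (hW : ∀ e : ℚ → Fin N,
      IndiscernibleOn (Δ : Set (Σ m : ℕ, L.Formula (Fin m × β))) (Q : Set ℚ) (fun q => b (e q)) →
        ∃ t ≤ n, (W (e ((2 * t : ℕ) : ℚ)) ↔ W (e ((2 * t + 1 : ℕ) : ℚ))))
    (hWb : ∀ i j, b i = b j → (W i ↔ W j)) {D : ℕ} (hQD : (Q.card + 1) * (2 * n + 3) ≤ D)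
    (hΔD : ∀ θ ∈ Δ, θ.1 ≤ D) :
    ∃ x : Fin n → Fin N, ∀ j j' : Fin N,
      (∀ k, b j = blockParams (ℓ := 2 * Q.card) hN b D x k ↔
        b j' = blockParams (ℓ := 2 * Q.card) hN b D x k) →
      (∀ θ ∈ Δ, ∀ g : Fin θ.1 → Option ((Fin n × Fin (2 * Q.card + 1)) ⊕ Fin (2 * D)),
        (θ.2.Realize (fun v => (g v.1).elim (b j) (blockParams hN b D x) v.2) ↔
          θ.2.Realize (fun v => (g v.1).elim (b j') (blockParams hN b D x) v.2))) →
      (W j ↔ W j') := by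
  classical
  -- It suffices to consider indices that are not those of parameters.
  suffices h : ∃ x : Fin n → Fin N, ∀ j j' : Fin N,
      (∀ k, b j ≠ blockParams (ℓ := 2 * Q.card) hN b D x k) →
      (∀ k, b j' ≠ blockParams (ℓ := 2 * Q.card) hN b D x k) →
      (∀ θ ∈ Δ, ∀ g : Fin θ.1 → Option ((Fin n × Fin (2 * Q.card + 1)) ⊕ Fin (2 * D)),
        (θ.2.Realize (fun v => (g v.1).elim (b j) (blockParams hN b D x) v.2) ↔
          θ.2.Realize (fun v => (g v.1).elim (b j') (blockParams hN b D x) v.2))) →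
      (W j ↔ W j') by
    obtain ⟨x, hx⟩ := h
    refine ⟨x, fun j j' h1 h2 => ?_⟩
    by_cases hk : ∃ k, b j = blockParams (ℓ := 2 * Q.card) hN b D x k
    · obtain ⟨k, hk⟩ := hk
      exact hWb _ _ (hk.trans ((h1 k).1 hk).symm)
    · push Not at hk
      exact hx j j' hk (fun k h => hk k ((h1 k).2 h)) h2
  have hmid : ∀ (x : Fin n → Fin N) (j : Fin N),
      (∀ k, b j ≠ blockParams (ℓ := 2 * Q.card) hN b D x k) → D ≤ (j : ℕ) ∧ (j : ℕ) + D < N := by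
    intro x j hj
    by_contra hcon
    obtain ⟨k, hk⟩ := exists_blockParams_eq (ℓ := 2 * Q.card) (D := D) hN b x j (by omega)
    exact hj k hk.symm
  by_cases hND : N ≤ D
  · refine ⟨fun _ => ⟨0, hN⟩, fun j j' hj _ _ => ?_⟩
    have := hmid _ j hj
    omega
  by_cases hsym : ∀ θ ∈ Δ, ∀ f g : Fin θ.1 → Fin N, Function.Injective f → Function.Injective g →
      (θ.2.Realize (fun v => b (f v.1) v.2) ↔ θ.2.Realize (fun v => b (g v.1) v.2))
  -- Symmetric case: the at most `n` exceptional indices become the starts of the blocks.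
  · have hE : ∃ E : Finset (Fin N), E.card ≤ n ∧ ∀ j j', j ∉ E → j' ∉ E → (W j ↔ W j') := by
      rcases card_filter_le_of_symmetric hsym hW (by omega) with h | h
      · refine ⟨_, h, fun j j' hj hj' => ?_⟩
        simp only [Finset.mem_filter, Finset.mem_univ, true_and] at hj hj'
        tauto
      · refine ⟨_, h, fun j j' hj hj' => ?_⟩
        simp only [Finset.mem_filter, Finset.mem_univ, true_and, not_not] at hj hj'
        tauto
    obtain ⟨E, hE, hEW⟩ := hE
    obtain ⟨x, hx⟩ := exists_fin_cover hN E hE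
    have hxE : ∀ j, (∀ k, b j ≠ blockParams (ℓ := 2 * Q.card) hN b D x k) → j ∉ E := by
      intro j hj hjE
      obtain ⟨t, rfl⟩ := hx j hjE
      refine hj (Sum.inl (t, 0)) ?_
      simp only [blockParams, Sum.elim_inl, entry]
      congr 1
      ext
      simp only [Fin.val_zero]
      omega
    exact ⟨x, fun j j' hj hj' _ => hEW j j' (hxE j hj) (hxE j' hj')⟩
  · push Not at hsym
    obtain ⟨θ, hθ, f₀, g₀, hf₀, hg₀, hfg⟩ := hsym
    obtain ⟨σ, r, r', hr, hswap⟩ := (hb.symmetric_or_swap θ.2).resolve_left (by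
      intro h
      have := h f₀ g₀ hf₀ hg₀
      tauto)
    have hcard : 2 * Q.card ≤ D := by nlinarith
    obtain ⟨x, hx⟩ := hb.exists_windows hW le_rfl hcard hN
    have hlt : ∀ j j' : Fin N, j < j' →
        (∀ k, b j ≠ blockParams (ℓ := 2 * Q.card) hN b D x k) →
        (∀ k, b j' ≠ blockParams (ℓ := 2 * Q.card) hN b D x k) →
        (∀ θ ∈ Δ, ∀ g : Fin θ.1 → Option ((Fin n × Fin (2 * Q.card + 1)) ⊕ Fin (2 * D)),
          (θ.2.Realize (fun v => (g v.1).elim (b j) (blockParams hN b D x) v.2) ↔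
            θ.2.Realize (fun v => (g v.1).elim (b j') (blockParams hN b D x) v.2))) →
        (W j ↔ W j') := by
      intro j j' hjj' hj hj' hagree
      have hDj := (hmid x j hj).1
      have hDj' := (hmid x j' hj').2
      -- A change at `i` would put `b i` into a window, hence among the parameters. Then `i ≠ j`, so
      -- `i` lies strictly between `j` and `j'`, and an instance of `θ` would separate them.
      have hstep : ∀ (i : ℕ) (hi : i + 1 < N), (j : ℕ) ≤ i → i < j' →
          (W ⟨i, by omega⟩ ↔ W ⟨i + 1, hi⟩) := by
        intro i hi hji hij'
        by_contra hne
        obtain ⟨t, ht1, ht2⟩ := hx i hi (hDj.trans hji) (by omega) hne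
        have hk : blockParams (ℓ := 2 * Q.card) hN b D x
            (Sum.inl (t, ⟨i - x t, by omega⟩)) = b ⟨i, by omega⟩ := by
          simp only [blockParams, Sum.elim_inl, entry]
          congr 1
          ext
          simp only
          omega
        have hji' : j < ⟨i, by omega⟩ := by
          refine lt_of_le_of_ne hji fun h => hj (Sum.inl (t, ⟨i - x t, by omega⟩)) ?_
          rw [hk, ← h]
        obtain ⟨g, hg⟩ := exists_not_agree_of_swap (hΔD θ hθ) hr hswap
          (exists_blockParams_eq hN b x) hDj hji' (show (⟨i, by omega⟩ : Fin N) < j' from hij')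
          hDj' hk
        exact hg (hagree θ hθ g)
      have hall : ∀ (i : ℕ) (_ : (j : ℕ) ≤ i) (hi : i < N), i ≤ j' → (W j ↔ W ⟨i, hi⟩) := by
        intro i hji
        induction i, hji using Nat.le_induction with
        | base => intro _ _; rfl
        | succ i hji ih =>
          intro hi hij'
          exact (ih (by omega) (by omega)).trans (hstep i hi hji (by omega))
      exact hall j' hjj'.le j'.2 le_rfl
    refine ⟨x, fun j j' hj hj' hagree => ?_⟩
    rcases lt_trichotomy j j' with h | rfl | h
    · exact hlt j j' h hj hj' hagree
    · rfl
    · exact (hlt j' j h hj' hj fun θ hθ g => (hagree θ hθ g).symm).symm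

end FiniteSequences

/-! ### From local dp-rank to uniform definability -/

section

variable {L : FirstOrder.Language.{u, v}} {M : Type w} [L.Structure M] {α : Type x} {β : Type y}
  {φ : L.Formula (α ⊕ β)} {p : Set (L.Formula α)}

theorem LocalDpRankLE.udtfsIndRankLE {κ : Cardinal.{w}} (hκ : ℵ₀ < κ) (hM : IsSaturated L M κ)
    [Finite α] [Finite β] {n : ℕ} (h : LocalDpRankLE M φ p n) : UDTFSindRankLE M φ p n := by
  classical
  obtain ⟨Q, Δ, p₀, hp₀, hQ⟩ := h.exists_finset hκ hM
  -- The first summand is the length required by the symmetric case and exceeds `2 * Q.card`; the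
  -- second bounds the arity of every formula in `Δ`.
  let D : ℕ := (Q.card + 1) * (2 * n + 3) + ∑ θ ∈ Δ, θ.1
  let ι := (Fin n × Fin (2 * Q.card + 1)) ⊕ Fin (2 * D)
  let var : ι → β → ((Fin n × Fin (2 * Q.card + 1)) × β) ⊕ (Fin (2 * D) × β) :=
    fun k s => k.elim (fun e => Sum.inl (e, s)) (fun h => Sum.inr (h, s))
  let η : (Σ θ : Δ, (Fin θ.1.1 → Option ι)) ⊕ ι →
      L.Formula (β ⊕ (((Fin n × Fin (2 * Q.card + 1)) × β) ⊕ (Fin (2 * D) × β))) :=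
    Sum.elim
      (fun θ => θ.1.1.2.relabel fun v =>
        (θ.2 v.1).elim (Sum.inl v.2) fun k => Sum.inr (var k v.2))
      (fun k => Language.Formula.iInf fun s : β =>
        Language.Term.equal (Language.Term.var (Sum.inl s))
          (Language.Term.var (Sum.inr (var k s))))
  obtain ⟨R, ψ, hψ⟩ := exists_boolean_combinations M η
  refine ⟨2 * Q.card, 2 * D, R, ψ, fun N hN b hb => ?_⟩
  refine ⟨fun h => if (h : ℕ) < D then ⟨min h (N - 1), by omega⟩
    else ⟨N - 1 - (h - D), by omega⟩, fun q hq => ?_⟩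
  -- The tuple `a` need only satisfy the finite part `p₀` of `p`, which is all that the compactness
  -- step requires.
  obtain ⟨a, ha, haq⟩ := exists_realize_of_mem_phiTypes (Set.finite_range b) hq p₀ hp₀
  obtain ⟨x, hx⟩ := hb.exists_blocks (Q := Q) (Δ := Δ) (n := n) (D := D)
    (W := fun i => φ.Realize (Sum.elim a (b i))) hN (fun e he => hQ a _ ha he)
    (fun i j hij => by simp only [hij]) (Nat.le_add_right _ _)
    (fun θ hθ => (Finset.single_le_sum (f := fun θ : Σ m : ℕ, L.Formula (Fin m × β) => θ.1)
      (fun _ _ => Nat.zero_le _) hθ).trans (Nat.le_add_left _ _))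
  refine ⟨x, ?_⟩
  let c : ((Fin n × Fin (2 * Q.card + 1)) × β) ⊕ (Fin (2 * D) × β) → M :=
    Sum.elim (fun v => entry hN b ((x v.1.1 : ℕ) + (v.1.2 : ℕ)) v.2)
      (fun v => b (if (v.1 : ℕ) < D then ⟨min v.1 (N - 1), by omega⟩
        else ⟨N - 1 - (v.1 - D), by omega⟩) v.2)
  have hc : ∀ k s, c (var k s) = blockParams hN b D x k s := by
    rintro (k | k) s <;> rfl
  have hη₁ : ∀ (b' : β → M) (θ : Δ) (g : Fin θ.1.1 → Option ι),
      (η (Sum.inl ⟨θ, g⟩)).Realize (Sum.elim b' c) ↔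
        θ.1.2.Realize (fun v => (g v.1).elim b' (blockParams hN b D x) v.2) := by
    intro b' θ g
    simp only [η, Sum.elim_inl, Language.Formula.realize_relabel]
    refine iff_of_eq (congrArg _ ?_)
    funext v
    simp only [Function.comp_apply]
    cases g v.1 with
    | none => rfl
    | some k => exact hc k v.2
  have hη₂ : ∀ (b' : β → M) (k : ι), (η (Sum.inr k)).Realize (Sum.elim b' c) ↔
      b' = blockParams hN b D x k := by
    intro b' k
    simp only [η, Sum.elim_inr, Language.Formula.realize_iInf, Language.Formula.realize_equal,
      Language.Term.realize_var, Sum.elim_inl, hc, funext_iff]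
  obtain ⟨r, hr⟩ := hψ c (Set.range b) (fun b' => φ.Realize (Sum.elim a b')) (by
    rintro _ ⟨j, rfl⟩ _ ⟨j', rfl⟩ hjj'
    refine (hx j j' (fun k => ?_) (fun θ hθ g => ?_)).1
    · rw [← hη₂, ← hη₂]; exact hjj' (Sum.inr k)
    · rw [← hη₁ _ ⟨θ, hθ⟩ g, ← hη₁ _ ⟨θ, hθ⟩ g]; exact hjj' (Sum.inl ⟨⟨θ, hθ⟩, g⟩))
  exact ⟨r, fun b' hb' => (hr b' hb').trans (haq b' hb')⟩

end

end LocalRank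

theorem mainTheorem1 {L : FirstOrder.Language.{u, v}} (T : L.Theory) (hT : T.IsComplete)
    (M : Type w) [L.Structure M] [M ⊨ T]
    (κ : Cardinal.{w}) (hκ : Cardinal.aleph0 < κ) (hM : LocalRank.IsSaturated L M κ)
    {α : Type x} {β : Type y} [Finite α] [Finite β]
    (φ : L.Formula (α ⊕ β)) (p : Set (L.Formula α)) (n : ℕ) :
    List.TFAE [
      LocalRank.LocalDpRankLE M φ p n,
      LocalRank.UDTFSindRankLE M φ p n,
      LocalRank.VCindDensityLE M φ p (n : ℝ),
      ∃ ℓ : ℝ, (n : ℝ) ≤ ℓ ∧ ℓ < (n : ℝ) + 1 ∧ LocalRank.VCindDensityLE M φ p ℓ] := by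
  tfae_have 1 → 2 := fun h => h.udtfsIndRankLE hκ hM
  tfae_have 2 → 3 := fun h => h.vcIndDensityLE
  tfae_have 3 → 4 := fun h => ⟨n, le_rfl, lt_add_one _, h⟩
  tfae_have 4 → 1 := fun ⟨_, _, h, h'⟩ => h'.localDpRankLE h
  tfae_finish
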